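/- Let $p\ge 2$, $N>p$, $0\le s\le 2$, $p<q<\frac{Np}{N-p}$, and let $\Omega\subset\mathbb R^N$ be a bounded domain with smooth boundary containing the origin. Let $\alpha$ satisfy $0<\alpha\le \frac{Np}{N-p}-q$ and $q+\alpha<p\left(1+\frac 2N\right)$. For $u\in W_0^{1,p}(\Omega)$ put $$J(u)=\frac1p\|\nabla u\|_p^p-\frac1q\int_\Omega|u|^q\ln|u|\,dx+\frac1{q^2}\|u\|_q^q .$$ Let $u_0\in W_0^{1,p}(\Omega)$, and let $u$ be a weak solution on $\Omega\times[0,T)$, $0<T\le\infty$, of $$|x|^{-s}u_t-\operatorname{div}(|\nabla u|^{p-2}\nabla u)=|u|^{q-2}u\ln|u|,\qquad u|_{\partial\Omega}=0,\qquad u(0)=u_0 .$$ That is: $u\in L^\infty(0,T';W_0^{1,p}(\Omega))$ and $|x|^{-s/2}u_t\in L^2(0,T';L^2(\Omega))$ for every finite $T'<T$ (and $u$ denotes the representative for which $t\mapsto |x|^{-s/2}u(t)\in L^2(\Omega)$ is continuous on $[0,T)$, with $u(t)\in W_0^{1,p}(\Omega)$ for every $t\in[0,T)$), $u(0)=u_0$,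 and for a.e. $t\in(0,T)$ one has $$\int_\Omega |x|^{-s}u_t\phi\,dx+\int_\Omega|\nabla u|^{p-2}\nabla u\cdot\nabla\phi\,dx=\int_\Omega|u|^{q-2}u\ln|u|\,\phi\,dx\quad\text{for all }\phi\in W_0^{1,p}(\Omega),$$ $$\int_0^t\left\||x|^{-s/2}u_\tau\right\|_2^2d\tau+J(u(t))=J(u_0).$$ Let $T$ be the maximal existence time of $u$, in the sense that either $T=\infty$, or $T<\infty$ and $u$ blows up at $T$, i.e. $\lim_{t\to T^-}\left\||x|^{-s/2}u(t)\right\|_2^2=+\infty$. Let $C$ be the optimal constant in the Hardy–Sobolev inequality $\int_{\mathbb R^N}|x|^{-s}|w|^2dx\le C\left(\int_{\mathbb R^N}|\nabla w|^{n}dx\right)^{\frac{N+2-s}{N}}$, $n=\frac{2N}{N+2-s}$, for $w\in W_0^{1,n}(\mathbb R^N)$; let $\widetilde C=C$ if $n=p$ and $\widetilde C=C|\Omega|^{\frac{N+2-s}{N}-\frac2p}$ if $n<p$; and let $C_1=\frac{\widetilde C}2$, $C_2=\frac{pq}{q-p}\frac{\widetilde C}2$, $L(0)=\frac12\left\||x|^{-s/2}u_0\right\|_2^2$.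 Assume $$0<C_2J(u_0)<L(0)-C_1 .$$ Let $C_*$ be the optimal constant of the embedding $W_0^{1,p}(\Omega)\hookrightarrow L^{\frac{Np}{N-p}}(\Omega)$ (the least $C_*\ge0$ with $\|w\|_{\frac{Np}{N-p}}\le C_*\|\nabla w\|_p$ for all $w$), and let $$\theta=\left(\frac12-\frac1{q+\alpha}\right)\left(\frac12-\frac{N-p}{Np}\right)^{-1},\qquad \kappa=\frac{(1-\theta)(q+\alpha)/2}{1-\theta(q+\alpha)/p}.$$ Then $\theta\in(0,1)$, $\kappa>1$, $C_*>0$, the time $T$ is finite (so $u$ blows up at $T$), and $$T\ \ge\ \frac{L(0)^{1-\kappa}}{\alpha^{-1}\left[C_*^{\theta(q+\alpha)}\,\alpha^{-\frac{\theta(q+\alpha)}p}\,[\operatorname{diam}(\Omega)]^{\frac{s(1-\theta)(q+\alpha)}2}\right]^{\frac p{p-\theta(q+\alpha)}}2^{\kappa}(\kappa-1)} .$$ -/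

import Mathlib

open MeasureTheory Filter Topology Set
open scoped ENNReal ContDiff

noncomputable section

namespace LogFiltration

/-- Euclidean space `ℝ^N`. -/
abbrev Eu (N : ℕ) : Type := EuclideanSpace ℝ (Fin N)

instance factOneLe (p : ℝ) [hp : Fact (2 ≤ p)] : Fact (1 ≤ ENNReal.ofReal p) :=
  ⟨by
    rw [← ENNReal.ofReal_one]
    exact ENNReal.ofReal_le_ofReal (le_trans one_le_two hp.out)⟩

/-- The boundary of `Ω` is smooth: near each boundary point, `Ω` is the negative side of a
`C^∞` function whose differential does not vanish at that point. -/
def HasSmoothBoundary {N : ℕ} (Ω : Set (Eu N)) : Prop :=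
  ∀ x ∈ frontier Ω, ∃ U ∈ 𝓝 x, ∃ ρ : Eu N → ℝ,
    ContDiff ℝ ∞ ρ ∧ fderiv ℝ ρ x ≠ 0 ∧ ∀ y ∈ U, (y ∈ Ω ↔ ρ y < 0)

/-- `φ ∈ C_c^∞(Ω)`. -/
def IsTestFunction {N : ℕ} (Ω : Set (Eu N)) (φ : Eu N → ℝ) : Prop :=
  ContDiff ℝ ∞ φ ∧ HasCompactSupport φ ∧ tsupport φ ⊆ Ω

/-- The Sobolev space `W_0^{1,p}(Ω)`: the closure, in `L^p(Ω) × L^p(Ω; ℝ^N)`, of the linear space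
of all pairs `(φ, ∇φ)` with `φ ∈ C_c^∞(Ω)`. An element is a function together with its
weak gradient. -/
def W0 (N : ℕ) (Ω : Set (Eu N)) (p : ℝ) [Fact (2 ≤ p)] :
    Submodule ℝ (Lp ℝ (ENNReal.ofReal p) (volume.restrict Ω) ×
      Lp (Eu N) (ENNReal.ofReal p) (volume.restrict Ω)) :=
  (Submodule.span ℝ {z | ∃ φ : Eu N → ℝ, IsTestFunction Ω φ ∧
    (z.1 : Eu N → ℝ) =ᵐ[volume.restrict Ω] φ ∧
    (z.2 : Eu N → Eu N) =ᵐ[volume.restrict Ω] gradient φ}).topologicalClosure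

section Space

variable {N : ℕ} {Ω : Set (Eu N)} {p : ℝ} [Fact (2 ≤ p)]

/-- The function underlying an element of `W_0^{1,p}(Ω)`. -/
def wval (u : W0 N Ω p) : Eu N → ℝ :=
  (((u : Lp ℝ (ENNReal.ofReal p) (volume.restrict Ω) ×
      Lp (Eu N) (ENNReal.ofReal p) (volume.restrict Ω)).1 :
    Lp ℝ (ENNReal.ofReal p) (volume.restrict Ω)) : Eu N → ℝ)

/-- The weak gradient of an element of `W_0^{1,p}(Ω)`. -/
def wgrad (u : W0 N Ω p) : Eu N → Eu N :=
  (((u : Lp ℝ (ENNReal.ofReal p) (volume.restrict Ω) ×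
      Lp (Eu N) (ENNReal.ofReal p) (volume.restrict Ω)).2 :
    Lp (Eu N) (ENNReal.ofReal p) (volume.restrict Ω)) : Eu N → Eu N)

/-- `J(u) = (1/p)‖∇u‖_p^p - (1/q)∫_Ω |u|^q ln|u| dx + (1/q²)‖u‖_q^q`. -/
def energyJ (q : ℝ) (u : W0 N Ω p) : ℝ :=
  1 / p * (∫ x in Ω, ‖wgrad u x‖ ^ p)
    - 1 / q * (∫ x in Ω, |wval u x| ^ q * Real.log |wval u x|)
    + 1 / q ^ 2 * ∫ x in Ω, |wval u x| ^ q

/-- `‖|x|^{-s/2} u‖_2^2 = ∫_Ω |x|^{-s} u² dx`. -/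
def weightedNormSq (s : ℝ) (u : W0 N Ω p) : ℝ :=
  ∫ x in Ω, ‖x‖ ^ (-s) * wval u x ^ 2

/-- `u` is a weak solution on `Ω × [0,T)`, `T ∈ (0,∞]`, of
`|x|^{-s} u_t - div(|∇u|^{p-2}∇u) = |u|^{q-2} u ln|u|`, with zero boundary values and `u(0) = u₀`.

The function `v` is `|x|^{-s/2} u_t ∈ L^2_loc([0,T); L²(Ω))`; it is tied to `u` by the fact that
`w = |x|^{-s/2} u` is the `L²(Ω)`-valued primitive of `v`. So `u` denotes the representative
for which `t ↦ |x|^{-s/2} u(t) ∈ L²(Ω)` is continuous on `[0,T)`. Integrability in time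
is required on `(0,T')` for every finite `T' < T`. -/
def IsWeakSolution (q s : ℝ) (u₀ : W0 N Ω p) (T : EReal) (u : ℝ → W0 N Ω p) : Prop :=
  (∀ T' : ℝ, (T' : EReal) < T → MemLp u ∞ (volume.restrict (Ioo 0 T'))) ∧
  u 0 = u₀ ∧
  ∃ v w : ℝ → Lp ℝ 2 (volume.restrict Ω),
    (∀ T' : ℝ, (T' : EReal) < T → MemLp v 2 (volume.restrict (Ioo 0 T'))) ∧
    (∀ t : ℝ, 0 ≤ t → (t : EReal) < T →
      (w t : Eu N → ℝ) =ᵐ[volume.restrict Ω] fun x => ‖x‖ ^ (-(s / 2)) * wval (u t) x) ∧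
    (∀ t : ℝ, 0 ≤ t → (t : EReal) < T → w t = w 0 + ∫ τ in (0 : ℝ)..t, v τ) ∧
    (∀ᵐ t : ℝ, 0 < t → (t : EReal) < T → ∀ φ : W0 N Ω p,
      (∫ x in Ω, ‖x‖ ^ (-(s / 2)) * v t x * wval φ x)
        + (∫ x in Ω, ‖wgrad (u t) x‖ ^ (p - 2) * inner ℝ (wgrad (u t) x) (wgrad φ x))
        = ∫ x in Ω, |wval (u t) x| ^ (q - 2) * wval (u t) x * Real.log |wval (u t) x| * wval φ x) ∧
    (∀ᵐ t : ℝ, 0 < t → (t : EReal) < T →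
      (∫ τ in (0 : ℝ)..t, ‖v τ‖ ^ 2) + energyJ q (u t) = energyJ q u₀)

/-- `u` blows up at the finite time `T`: `‖|x|^{-s/2} u(t)‖_2^2 → +∞` as `t → T⁻`. -/
def BlowsUpAt (s : ℝ) (u : ℝ → W0 N Ω p) (T : ℝ) : Prop :=
  Tendsto (fun t => weightedNormSq s (u t)) (𝓝[<] T) atTop

end Space

/-- The optimal constant `C` in the Hardy-Sobolev inequality
`∫ |x|^{-s} u² dx ≤ C (∫ |∇u|^n dx)^{(N+2-s)/N}`, `n = 2N/(N+2-s)`, on `ℝ^N`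
(it is enough to test with `u ∈ C_c^∞(ℝ^N)`, which is dense in `W_0^{1,n}(ℝ^N)`). -/
def hardySobolevConst (N : ℕ) (s : ℝ) : ℝ :=
  sInf {C : ℝ | 0 ≤ C ∧ ∀ φ : Eu N → ℝ, IsTestFunction Set.univ φ →
    (∫ x, ‖x‖ ^ (-s) * φ x ^ 2) ≤
      C * (∫ x, ‖gradient φ x‖ ^ (2 * N / (N + 2 - s))) ^ ((N + 2 - s) / N)}

open Classical in
/-- The constant `C̃`: `C` if `2N/(N+2-s) = p`, and `C |Ω|^{(N+2-s)/N - 2/p}` otherwise. -/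
def tildeC (N : ℕ) (Ω : Set (Eu N)) (p s : ℝ) : ℝ :=
  if 2 * N / (N + 2 - s) = p then hardySobolevConst N s
  else hardySobolevConst N s * volume.real Ω ^ ((N + 2 - s) / N - 2 / p)

/-- The optimal constant `C_*` of the embedding `W_0^{1,p}(Ω) ↪ L^{Np/(N-p)}(Ω)`, i.e. the least
`C ≥ 0` with `‖u‖_{Np/(N-p)} ≤ C ‖∇u‖_p` for all `u ∈ W_0^{1,p}(Ω)`. -/
def sobolevConst (N : ℕ) (Ω : Set (Eu N)) (p : ℝ) [Fact (2 ≤ p)] : ℝ :=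
  sInf {C : ℝ | 0 ≤ C ∧ ∀ u : W0 N Ω p,
    eLpNorm (wval u) (ENNReal.ofReal (N * p / (N - p))) (volume.restrict Ω) ≤
      ENNReal.ofReal C * eLpNorm (wgrad u) (ENNReal.ofReal p) (volume.restrict Ω)}

/-- `θ = (1/2 - 1/(q+α)) (1/2 - (N-p)/(Np))⁻¹`. -/
def thetaExp (N : ℕ) (p q α : ℝ) : ℝ :=
  (1 / 2 - 1 / (q + α)) * (1 / 2 - (N - p) / (N * p))⁻¹

/-- `κ = [(1-θ)(q+α)/2] / [1 - θ(q+α)/p]`. -/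
def kappaExp (N : ℕ) (p q α : ℝ) : ℝ :=
  ((1 - thetaExp N p q α) * (q + α) / 2) / (1 - thetaExp N p q α * (q + α) / p)

/-- The lower bound for the blow-up time, as a function of `L0 = L(0)`. -/
def lowerBound (N : ℕ) (Ω : Set (Eu N)) (p q s α : ℝ) [Fact (2 ≤ p)] (L0 : ℝ) : ℝ :=
  let θ := thetaExp N p q α
  let κ := kappaExp N p q α
  L0 ^ (1 - κ) /
    (α⁻¹ *
      (sobolevConst N Ω p ^ (θ * (q + α)) * α ^ (-(θ * (q + α) / p)) *
        Metric.diam Ω ^ (s * (1 - θ) * (q + α) / 2)) ^ (p / (p - θ * (q + α))) *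
      2 ^ κ * (κ - 1))

end LogFiltration

end

/-!
Write `L(t) = ½ ‖w(t)‖²` with `w = |x|^{-s/2} u`, so that `w' = v = |x|^{-s/2} u_t` in `L²(Ω)`.
Testing the equation with `u` gives `L' = ∫ |u|^q ln|u| - ‖∇u‖_p^p` for almost every time.

*Finiteness of `T`* is a concavity argument. Eliminating the logarithmic term by means of `J` and
applying the Hardy-Sobolev inequality gives `L' ≥ k M` for `M = L - C₁ - C₂ J(u)`, where
`k C₂ = q` (`coercivity`). By the energy identity `M' = L' + C₂ ‖v‖²`, and `L'² ≤ 2 L ‖v‖²` by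
Cauchy-Schwarz (`exists_concavityIneq`). Since `M(0) > 0`, Grönwall's inequality keeps `M`
positive, so `L` is nondecreasing; moreover `M' ≥ (q/2) M L' / L`, so `M L^{-q/2}` is nondecreasing
and `L' ≥ k c L^{q/2}` with `q/2 > 1`. Hence `L^{1-q/2} > 0` decreases at least linearly, which is
impossible for all times (`ConcavityIneq.rpow_le`). All of these functions of time are only
absolutely continuous, and the differential inequalities hold almost everywhere.

*The lower bound for `T`* comes from the opposite estimate `L' ≤ K L^κ` (`reaction_le`): bound
`ln|u|` by `|u|^α / α`, interpolate `L^{q+α}` between `L²` and the Sobolev exponent, and absorb the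
gradient by Young's inequality, which is possible because `θ (q + α) < p`. Integrating up to the
blow-up time gives `L(0)^{1-κ} ≤ K (κ - 1) T`.

The functional inequalities are proved for test functions and carried over to `W_0^{1,p}(Ω)` by
Fatou's lemma (`eLpNorm_mul_wval_le`). The Sobolev inequality is Mathlib's. The Hardy-Sobolev
inequality is the one that defines `C`: the hypothesis `0 < C₂ J(u₀)` makes `C̃` nonzero, and the
optimal constant can be nonzero only if some constant is admissible.
-/

namespace LogFiltration

/-! ### Differential inequalities for absolutely continuous functions -/

/-- Absolute continuity passes to a function whose increments are dominated by those of an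
absolutely continuous one. This covers Lipschitz compositions as well as primitives with values in
a normed space. -/
theorem absolutelyContinuousOnInterval_of_dist_le {X Y : Type*} [PseudoMetricSpace X]
    [PseudoMetricSpace Y] {f : ℝ → X} {g : ℝ → Y} {a b K : ℝ}
    (hg : AbsolutelyContinuousOnInterval g a b)
    (h : ∀ x ∈ uIcc a b, ∀ y ∈ uIcc a b, dist (f x) (f y) ≤ K * dist (g x) (g y)) :
    AbsolutelyContinuousOnInterval f a b := by
  have h0 : Tendsto (fun E : ℕ × (ℕ → ℝ × ℝ) ↦
      K * ∑ i ∈ Finset.range E.1, dist (g (E.2 i).1) (g (E.2 i).2))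
      (AbsolutelyContinuousOnInterval.totalLengthFilter ⊓
        𝓟 (AbsolutelyContinuousOnInterval.disjWithin a b)) (𝓝 0) := by
    simpa using Tendsto.const_mul K hg
  refine squeeze_zero' (Eventually.of_forall fun E => Finset.sum_nonneg fun i _ => dist_nonneg)
    ?_ h0
  filter_upwards [mem_inf_of_right (mem_principal_self _)] with E hE
  rw [Finset.mul_sum]
  exact Finset.sum_le_sum fun i hi => h _ (hE.1 i hi).1 _ (hE.1 i hi).2

theorem absolutelyContinuousOnInterval_rpow {f : ℝ → ℝ} {a b : ℝ}
    (hf : AbsolutelyContinuousOnInterval f a b) (hpos : ∀ x ∈ uIcc a b, 0 < f x) (r : ℝ) :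
    AbsolutelyContinuousOnInterval (fun t => f t ^ r) a b := by
  obtain ⟨x₀, hx₀, hmin⟩ := isCompact_uIcc.exists_isMinOn nonempty_uIcc hf.continuousOn
  obtain ⟨x₁, hx₁, hmax⟩ := isCompact_uIcc.exists_isMaxOn nonempty_uIcc hf.continuousOn
  have hC : ContDiffOn ℝ 1 (fun y : ℝ => y ^ r) (Icc (f x₀) (f x₁)) := fun y hy =>
    (Real.contDiffAt_rpow_const_of_ne
      ((hpos x₀ hx₀).trans_le hy.1).ne').contDiffWithinAt
  obtain ⟨K, hK⟩ := hC.exists_lipschitzOnWith (by decide) (convex_Icc _ _) isCompact_Icc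
  exact absolutelyContinuousOnInterval_of_dist_le (K := K) hf fun x hx y hy =>
    hK.dist_le_mul _ ⟨hmin hx, hmax hx⟩ _ ⟨hmin hy, hmax hy⟩

theorem ae_mem_Ioc_of_ae_mem_Ioo {b : ℝ} {P : ℝ → Prop} (h : ∀ᵐ t : ℝ, t ∈ Ioo 0 b → P t) :
    ∀ᵐ t : ℝ, t ∈ Ioc 0 b → P t := by
  filter_upwards [h, Measure.ae_ne volume b] with t ht htb hm
  exact ht ⟨hm.1, lt_of_le_of_ne hm.2 htb⟩

theorem le_of_ae_hasDerivAt_nonneg {f : ℝ → ℝ} {b : ℝ} (hb : 0 ≤ b)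
    (hf : AbsolutelyContinuousOnInterval f 0 b)
    (h : ∀ᵐ t : ℝ, t ∈ Ioo 0 b → ∃ d, HasDerivAt f d t ∧ 0 ≤ d) : f 0 ≤ f b := by
  have h1 : 0 ≤ ∫ t in (0 : ℝ)..b, deriv f t := by
    rw [intervalIntegral.integral_of_le hb]
    refine setIntegral_nonneg_of_ae_restrict ?_
    rw [EventuallyLE, ae_restrict_iff' measurableSet_Ioc]
    filter_upwards [ae_mem_Ioc_of_ae_mem_Ioo h] with t ht hm
    obtain ⟨d, hd, hd0⟩ := ht hm
    simpa [hd.deriv] using hd0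
  rw [hf.integral_deriv_eq_sub] at h1
  linarith

theorem absolutelyContinuousOnInterval_linear (c a b : ℝ) :
    AbsolutelyContinuousOnInterval (fun t : ℝ => c * t) a b :=
  ContDiffOn.absolutelyContinuousOnInterval (by fun_prop)

theorem add_mul_le_of_ae_hasDerivAt_ge {f : ℝ → ℝ} {b c : ℝ} (hb : 0 ≤ b)
    (hf : AbsolutelyContinuousOnInterval f 0 b)
    (h : ∀ᵐ t : ℝ, t ∈ Ioo 0 b → ∃ d, HasDerivAt f d t ∧ c ≤ d) : f 0 + c * b ≤ f b := by
  have := le_of_ae_hasDerivAt_nonneg hb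
    (hf.fun_sub (absolutelyContinuousOnInterval_linear c 0 b)) (by
      filter_upwards [h] with t ht hm
      obtain ⟨d, hd, hcd⟩ := ht hm
      refine ⟨d - c * 1, hd.sub ((hasDerivAt_id t).const_mul c), by linarith⟩)
  simp only [mul_zero, sub_zero] at this
  linarith

/-- Grönwall's inequality from below: `f' ≥ k f` preserves positivity. -/
theorem pos_of_ae_hasDerivAt_ge_mul {f : ℝ → ℝ} {b k : ℝ} (hb : 0 ≤ b)
    (hf : AbsolutelyContinuousOnInterval f 0 b) (h0 : 0 < f 0)
    (h : ∀ᵐ t : ℝ, t ∈ Ioo 0 b → ∃ d, HasDerivAt f d t ∧ k * f t ≤ d) : 0 < f b := by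
  -- The product `f(t) exp(-k t)` is nondecreasing.
  have hE : AbsolutelyContinuousOnInterval (fun t : ℝ => Real.exp (-k * t)) 0 b :=
    ContDiffOn.absolutelyContinuousOnInterval (by fun_prop)
  have := le_of_ae_hasDerivAt_nonneg hb (hf.fun_mul hE) (by
      filter_upwards [h] with t ht hm
      obtain ⟨d, hd, hcd⟩ := ht hm
      refine ⟨_, hd.mul (((hasDerivAt_id t).const_mul (-k)).exp), ?_⟩
      have := Real.exp_pos (-k * t)
      simp only [id, mul_one]
      nlinarith)
  simp only [mul_zero, Real.exp_zero, mul_one] at this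
  exact pos_of_mul_pos_left (h0.trans_le this) (Real.exp_pos _).le

section Concavity

variable {L M : ℝ → ℝ} {b k q : ℝ}

/-- The hypotheses of the concavity method on `[0, b]`: `L` and `M` are absolutely continuous and,
almost everywhere, `L' ≥ k M` while the excess `M' - L'` is nonnegative and satisfies
`q L'² ≤ 2 k L (M' - L')`. -/
def ConcavityIneq (L M : ℝ → ℝ) (b k q : ℝ) : Prop :=
  AbsolutelyContinuousOnInterval L 0 b ∧ AbsolutelyContinuousOnInterval M 0 b ∧
  ∀ᵐ t : ℝ, t ∈ Ioo 0 b → ∃ l m, HasDerivAt L l t ∧ HasDerivAt M m t ∧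
    k * M t ≤ l ∧ l ≤ m ∧ q * l ^ 2 ≤ 2 * k * L t * (m - l)

theorem ConcavityIneq.mono (h : ConcavityIneq L M b k q) {t : ℝ} (ht : t ∈ Icc 0 b) :
    ConcavityIneq L M t k q := by
  have hs : uIcc 0 t ⊆ uIcc 0 b := by
    rw [uIcc_of_le ht.1, uIcc_of_le (ht.1.trans ht.2)]
    exact Icc_subset_Icc_right ht.2
  refine ⟨h.1.mono hs, h.2.1.mono hs, ?_⟩
  filter_upwards [h.2.2] with x hx hm
  exact hx ⟨hm.1, hm.2.trans_le ht.2⟩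

theorem ConcavityIneq.pos (h : ConcavityIneq L M b k q) (hM : 0 < M 0) {t : ℝ}
    (ht : t ∈ Icc 0 b) : 0 < M t := by
  refine pos_of_ae_hasDerivAt_ge_mul (k := k) ht.1 (h.mono ht).2.1 hM ?_
  filter_upwards [(h.mono ht).2.2] with x hx hm
  obtain ⟨l, m, -, hm', h1, h2, -⟩ := hx hm
  exact ⟨m, hm', h1.trans h2⟩

theorem ConcavityIneq.le (h : ConcavityIneq L M b k q) (hk : 0 ≤ k) (hM : 0 < M 0) {t : ℝ}
    (ht : t ∈ Icc 0 b) : L 0 ≤ L t := by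
  refine le_of_ae_hasDerivAt_nonneg ht.1 (h.mono ht).1 ?_
  filter_upwards [(h.mono ht).2.2] with x hx hm
  obtain ⟨l, m, hl, -, h1, -⟩ := hx hm
  exact ⟨l, hl, (mul_nonneg hk (h.pos hM ⟨hm.1.le, hm.2.le.trans ht.2⟩).le).trans h1⟩

/-- `M L^{-q/2}` is nondecreasing, because `M' ≥ (q/2) M L' / L`. -/
theorem ConcavityIneq.mul_rpow_le (h : ConcavityIneq L M b k q) (hk : 0 < k) (hq : 0 < q)
    (hM : 0 < M 0) (hL : 0 < L 0) {t : ℝ} (ht : t ∈ Icc 0 b) :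
    M 0 * L 0 ^ (-(q / 2)) ≤ M t * L t ^ (-(q / 2)) := by
  have hLpos : ∀ x ∈ Icc 0 b, 0 < L x := fun x hx => hL.trans_le (h.le hk.le hM hx)
  have ht' := h.mono ht
  refine le_of_ae_hasDerivAt_nonneg (f := fun t => M t * L t ^ (-(q / 2))) ht.1
    (ht'.2.1.fun_mul (absolutelyContinuousOnInterval_rpow ht'.1 ?_ _)) ?_
  · rw [uIcc_of_le ht.1]
    exact fun x hx => hLpos x ⟨hx.1, hx.2.trans ht.2⟩
  filter_upwards [ht'.2.2] with x hx hm
  obtain ⟨l, m, hl, hm', h1, h2, h3⟩ := hx hm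
  have hxb : x ∈ Icc 0 b := ⟨hm.1.le, hm.2.le.trans ht.2⟩
  have hLx := hLpos x hxb
  have hMx := h.pos hM hxb
  refine ⟨_, hm'.mul (hl.rpow_const (p := -(q / 2)) (Or.inl hLx.ne')), ?_⟩
  rw [Real.rpow_sub_one hLx.ne']
  have hl0 : 0 ≤ l := (mul_pos hk hMx).le.trans h1
  have key : q * M x * l ≤ 2 * L x * (m - l) := by
    have : k * (q * M x * l) ≤ k * (2 * L x * (m - l)) := by
      have := mul_le_mul_of_nonneg_left h1 (mul_nonneg hq.le hl0)
      nlinarith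
    exact le_of_mul_le_mul_left this hk
  have e : m * L x ^ (-(q / 2)) + M x * (l * -(q / 2) * (L x ^ (-(q / 2)) / L x))
      = L x ^ (-(q / 2)) / L x * (m * L x - q / 2 * (M x * l)) := by
    field_simp
    ring
  rw [e]
  refine mul_nonneg (div_nonneg (Real.rpow_nonneg hLx.le _) hLx.le) ?_
  nlinarith

/-- Superlinear growth: `L' ≥ k M ≥ k c L^{q/2}` forces `L^{1-q/2}` to decrease at least linearly. -/
theorem ConcavityIneq.rpow_le (h : ConcavityIneq L M b k q) (hk : 0 < k) (hq : 2 < q)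
    (hM : 0 < M 0) (hL : 0 < L 0) (hb : 0 ≤ b) :
    (q / 2 - 1) * (k * (M 0 * L 0 ^ (-(q / 2)))) * b ≤ L 0 ^ (1 - q / 2) := by
  have hLpos : ∀ x ∈ Icc 0 b, 0 < L x := fun x hx => hL.trans_le (h.le hk.le hM hx)
  have h1 := add_mul_le_of_ae_hasDerivAt_ge (f := fun t => -L t ^ (1 - q / 2))
    (c := (q / 2 - 1) * (k * (M 0 * L 0 ^ (-(q / 2))))) hb
    (absolutelyContinuousOnInterval_rpow h.1 (by rwa [uIcc_of_le hb]) _).fun_neg (by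
      filter_upwards [h.2.2] with x hx hm
      obtain ⟨l, m, hl, -, h1, -⟩ := hx hm
      have hxb : x ∈ Icc 0 b := ⟨hm.1.le, hm.2.le⟩
      have hLx := hLpos x hxb
      refine ⟨_, (hl.rpow_const (p := 1 - q / 2) (Or.inl hLx.ne')).neg, ?_⟩
      rw [show 1 - q / 2 - 1 = -(q / 2) by ring]
      have h4 := h.mul_rpow_le hk (by linarith) hM hL hxb
      have h5 : k * (M 0 * L 0 ^ (-(q / 2))) ≤ l * L x ^ (-(q / 2)) :=
        calc _ ≤ k * (M x * L x ^ (-(q / 2))) := mul_le_mul_of_nonneg_left h4 hk.le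
          _ = (k * M x) * L x ^ (-(q / 2)) := by ring
          _ ≤ _ := mul_le_mul_of_nonneg_right h1 (Real.rpow_nonneg hLx.le _)
      nlinarith)
  have := Real.rpow_nonneg (hLpos b ⟨hb, le_rfl⟩).le (1 - q / 2)
  linarith

end Concavity

/-- A function with `f' ≤ K f^κ`, `κ > 1`, cannot blow up before the solution of the corresponding
ordinary differential equation does. -/
theorem rpow_sub_rpow_le_of_ae_hasDerivAt_le {f : ℝ → ℝ} {b K κ : ℝ} (hκ : 1 < κ) (hb : 0 ≤ b)
    (hf : AbsolutelyContinuousOnInterval f 0 b) (hpos : ∀ t ∈ Icc 0 b, 0 < f t)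
    (h : ∀ᵐ t : ℝ, t ∈ Ioo 0 b → ∃ d, HasDerivAt f d t ∧ d ≤ K * f t ^ κ) :
    f 0 ^ (1 - κ) - f b ^ (1 - κ) ≤ K * (κ - 1) * b := by
  have h1 := add_mul_le_of_ae_hasDerivAt_ge (f := fun t => f t ^ (1 - κ)) (c := -(K * (κ - 1)))
    hb (absolutelyContinuousOnInterval_rpow hf (by rwa [uIcc_of_le hb]) _) (by
      filter_upwards [h] with x hx hm
      obtain ⟨d, hd, hdK⟩ := hx hm
      have hfx := hpos x ⟨hm.1.le, hm.2.le⟩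
      refine ⟨_, hd.rpow_const (p := 1 - κ) (Or.inl hfx.ne'), ?_⟩
      rw [show 1 - κ - 1 = -κ by ring]
      have h2 : d * f x ^ (-κ) ≤ K := by
        rw [Real.rpow_neg hfx.le, ← div_eq_mul_inv, div_le_iff₀ (Real.rpow_pos_of_pos hfx _)]
        exact hdK
      nlinarith)
  linarith

/-! ### Primitives of square-integrable curves in a Hilbert space -/

section Hilbert

variable {H : Type*} [NormedAddCommGroup H] {v w : ℝ → H} {b : ℝ}

theorem intervalIntegrable_of_memLp_two (hb : 0 ≤ b) (hv : MemLp v 2 (volume.restrict (Ioo 0 b))) :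
    IntervalIntegrable v volume 0 b := by
  rw [intervalIntegrable_iff_integrableOn_Ioo_of_le hb]
  exact hv.integrable (by norm_num)

theorem intervalIntegrable_norm_sq_of_memLp_two (hb : 0 ≤ b)
    (hv : MemLp v 2 (volume.restrict (Ioo 0 b))) :
    IntervalIntegrable (fun t => ‖v t‖ ^ 2) volume 0 b := by
  rw [intervalIntegrable_iff_integrableOn_Ioo_of_le hb]
  exact hv.integrable_norm_pow (by norm_num)

theorem absolutelyContinuousOnInterval_of_eq_add_integral [NormedSpace ℝ H] (hb : 0 ≤ b)
    (hv : MemLp v 2 (volume.restrict (Ioo 0 b)))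
    (hw : ∀ t ∈ Icc 0 b, w t = w 0 + ∫ τ in (0 : ℝ)..t, v τ) :
    AbsolutelyContinuousOnInterval w 0 b := by
  have hi := intervalIntegrable_of_memLp_two hb hv
  refine absolutelyContinuousOnInterval_of_dist_le (K := 1)
    (hi.norm.absolutelyContinuousOnInterval_intervalIntegral left_mem_uIcc) ?_
  have hsub : ∀ x ∈ uIcc 0 b, IntervalIntegrable v volume 0 x := fun x hx =>
    hi.mono_set (uIcc_subset_uIcc left_mem_uIcc hx)
  intro x hx y hy
  have hxy : IntervalIntegrable v volume y x := (hsub y hy).symm.trans (hsub x hx)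
  rw [uIcc_of_le hb] at hx hy
  rw [one_mul, hw x hx, hw y hy, dist_add_left, dist_eq_norm, Real.dist_eq,
    intervalIntegral.integral_interval_sub_left (hsub x (by rwa [uIcc_of_le hb]))
      (hsub y (by rwa [uIcc_of_le hb])),
    intervalIntegral.integral_interval_sub_left (hsub x (by rwa [uIcc_of_le hb])).norm
      (hsub y (by rwa [uIcc_of_le hb])).norm]
  exact intervalIntegral.norm_integral_le_abs_integral_norm

theorem absolutelyContinuousOnInterval_half_norm_sq {a : ℝ}
    (hw : AbsolutelyContinuousOnInterval w a b) :
    AbsolutelyContinuousOnInterval (fun t => 1 / 2 * ‖w t‖ ^ 2) a b := by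
  have hn : AbsolutelyContinuousOnInterval (fun t => ‖w t‖) a b :=
    absolutelyContinuousOnInterval_of_dist_le (K := 1) hw fun x _ y _ => by
      rw [one_mul, dist_eq_norm (w x), Real.dist_eq]
      exact abs_norm_sub_norm_le _ _
  simpa only [sq] using (hn.fun_mul hn).const_mul (1 / 2)

theorem ae_hasDerivAt_half_norm_sq [InnerProductSpace ℝ H] [CompleteSpace H] (hb : 0 ≤ b)
    (hv : MemLp v 2 (volume.restrict (Ioo 0 b)))
    (hw : ∀ t ∈ Icc 0 b, w t = w 0 + ∫ τ in (0 : ℝ)..t, v τ) :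
    ∀ᵐ t : ℝ, t ∈ Ioo 0 b → HasDerivAt (fun t => 1 / 2 * ‖w t‖ ^ 2) (inner ℝ (w t) (v t)) t := by
  filter_upwards [(intervalIntegrable_of_memLp_two hb hv).ae_hasDerivAt_integral] with t ht hm
  have h1 := (ht (by rw [uIcc_of_le hb]; exact Ioo_subset_Icc_self hm) 0 left_mem_uIcc).const_add
    (w 0)
  have h2 : HasDerivAt w (v t) t := h1.congr_of_eventuallyEq (by
    filter_upwards [Ioo_mem_nhds hm.1 hm.2] with x hx using hw x (Ioo_subset_Icc_self hx))
  exact (h2.norm_sq.const_mul (1 / 2)).congr_deriv (by ring)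

end Hilbert

/-! ### From test functions to `W_0^{1,p}` -/

section Density

variable {N : ℕ} {Ω : Set (Eu N)} {φ ψ : Eu N → ℝ}

theorem IsTestFunction.differentiable (hφ : IsTestFunction Ω φ) : Differentiable ℝ φ :=
  hφ.1.differentiable (by simp)

theorem gradient_add_of_differentiable (hφ : Differentiable ℝ φ) (hψ : Differentiable ℝ ψ) :
    gradient (φ + ψ) = gradient φ + gradient ψ := by
  ext1 x
  simp [gradient, fderiv_add (hφ x) (hψ x)]

theorem gradient_smul_of_differentiable (hφ : Differentiable ℝ φ) (c : ℝ) :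
    gradient (c • φ) = c • gradient φ := by
  ext1 x
  simp [gradient, fderiv_const_smul (hφ x) c]

theorem IsTestFunction.add (hφ : IsTestFunction Ω φ) (hψ : IsTestFunction Ω ψ) :
    IsTestFunction Ω (φ + ψ) :=
  ⟨hφ.1.add hψ.1, hφ.2.1.add hψ.2.1,
    (tsupport_add φ ψ).trans (union_subset hφ.2.2 hψ.2.2)⟩

theorem IsTestFunction.smul (hφ : IsTestFunction Ω φ) (c : ℝ) : IsTestFunction Ω (c • φ) :=
  ⟨contDiff_const.smul hφ.1, hφ.2.1.smul_left,
    (closure_mono (Function.support_const_smul_subset c φ)).trans hφ.2.2⟩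

theorem isTestFunction_zero : IsTestFunction Ω (0 : Eu N → ℝ) :=
  ⟨contDiff_const, HasCompactSupport.zero, by simp [tsupport]⟩

theorem norm_gradient_eq_norm_fderiv (x : Eu N) : ‖gradient φ x‖ = ‖fderiv ℝ φ x‖ := by
  simp [gradient]

theorem IsTestFunction.continuous_gradient (hφ : IsTestFunction Ω φ) :
    Continuous (gradient φ) :=
  (InnerProductSpace.toDual ℝ (Eu N)).symm.continuous.comp (hφ.1.continuous_fderiv (by simp))

theorem support_gradient_subset_tsupport : Function.support (gradient φ) ⊆ tsupport φ := by
  intro x hx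
  refine support_fderiv_subset ℝ (f := φ) fun h => hx ?_
  rw [← norm_eq_zero, norm_gradient_eq_norm_fderiv, h, norm_zero]

theorem IsTestFunction.hasCompactSupport_gradient (hφ : IsTestFunction Ω φ) :
    HasCompactSupport (gradient φ) :=
  HasCompactSupport.of_support_subset_isCompact hφ.2.1 support_gradient_subset_tsupport

theorem IsTestFunction.eLpNorm_gradient_restrict (hφ : IsTestFunction Ω φ) (r : ℝ≥0∞) :
    eLpNorm (gradient φ) r (volume.restrict Ω) = eLpNorm (gradient φ) r volume :=
  eLpNorm_restrict_eq_of_support_subset (support_gradient_subset_tsupport.trans hφ.2.2)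

variable {p : ℝ}

/-- The pairs `(φ, ∇φ)` already form a linear subspace, so that taking the span adds nothing. -/
theorem exists_isTestFunction_of_mem_span
    {z : Lp ℝ (ENNReal.ofReal p) (volume.restrict Ω) ×
      Lp (Eu N) (ENNReal.ofReal p) (volume.restrict Ω)}
    (hz : z ∈ Submodule.span ℝ {z : Lp ℝ (ENNReal.ofReal p) (volume.restrict Ω) ×
      Lp (Eu N) (ENNReal.ofReal p) (volume.restrict Ω) | ∃ φ : Eu N → ℝ, IsTestFunction Ω φ ∧
        (z.1 : Eu N → ℝ) =ᵐ[volume.restrict Ω] φ ∧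
        (z.2 : Eu N → Eu N) =ᵐ[volume.restrict Ω] gradient φ}) :
    ∃ φ : Eu N → ℝ, IsTestFunction Ω φ ∧ (z.1 : Eu N → ℝ) =ᵐ[volume.restrict Ω] φ ∧
      (z.2 : Eu N → Eu N) =ᵐ[volume.restrict Ω] gradient φ := by
  induction hz using Submodule.span_induction with
  | mem z hz => exact hz
  | zero =>
    refine ⟨0, isTestFunction_zero, Lp.coeFn_zero _ _ _, (Lp.coeFn_zero _ _ _).trans ?_⟩
    refine Eventually.of_forall fun x => ?_
    simp [gradient]
  | add y z _ _ hy hz =>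
    obtain ⟨φ, h1, h2, h3⟩ := hy
    obtain ⟨ψ, k1, k2, k3⟩ := hz
    refine ⟨φ + ψ, h1.add k1, (Lp.coeFn_add _ _).trans (h2.add k2),
      (Lp.coeFn_add _ _).trans ?_⟩
    rw [gradient_add_of_differentiable h1.differentiable k1.differentiable]
    exact h3.add k3
  | smul c z _ hz =>
    obtain ⟨φ, h1, h2, h3⟩ := hz
    refine ⟨c • φ, h1.smul c, (Lp.coeFn_smul _ _).trans (h2.const_smul c),
      (Lp.coeFn_smul _ _).trans ?_⟩
    rw [gradient_smul_of_differentiable h1.differentiable]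
    exact h3.const_smul c

/-- A weighted inequality for test functions extends to `W_0^{1,p}(Ω)`: pass to an almost
everywhere convergent subsequence and use Fatou's lemma. -/
theorem eLpNorm_mul_wval_le [Fact (2 ≤ p)] {g : Eu N → ℝ} (hg : Measurable g) {r K : ℝ≥0∞} (hK : K ≠ ⊤)
    (h : ∀ φ : Eu N → ℝ, IsTestFunction Ω φ →
      eLpNorm (fun x => g x * φ x) r (volume.restrict Ω) ≤
        K * eLpNorm (gradient φ) (ENNReal.ofReal p) (volume.restrict Ω)) (u : W0 N Ω p) :
    eLpNorm (fun x => g x * wval u x) r (volume.restrict Ω) ≤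
      K * eLpNorm (wgrad u) (ENNReal.ofReal p) (volume.restrict Ω) := by
  obtain ⟨z, hz, hlim⟩ := mem_closure_iff_seq_limit.1 u.2
  obtain ⟨ns, hns, hae⟩ := (tendstoInMeasure_of_tendsto_Lp
    ((continuous_fst.tendsto _).comp hlim)).exists_seq_tendsto_ae
  have h2 : Tendsto (fun k => K * ‖(z (ns k)).2‖ₑ) atTop (𝓝 (K * ‖u.1.2‖ₑ)) :=
    ENNReal.Tendsto.const_mul ((((continuous_enorm.comp continuous_snd).tendsto _).comp
      hlim).comp hns.tendsto_atTop) (Or.inr hK)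
  have h3 : ∀ k, eLpNorm (fun x => g x * (z (ns k)).1 x) r (volume.restrict Ω) ≤
      K * ‖(z (ns k)).2‖ₑ := by
    intro k
    obtain ⟨φ, hφ, e1, e2⟩ := exists_isTestFunction_of_mem_span (hz (ns k))
    rw [Lp.enorm_def, eLpNorm_congr_ae e2,
      eLpNorm_congr_ae (g := fun x => g x * φ x) (by filter_upwards [e1] with x hx; rw [hx])]
    exact h φ hφ
  calc _ ≤ atTop.liminf fun k =>
        eLpNorm (fun x => g x * (z (ns k)).1 x) r (volume.restrict Ω) :=
      Lp.eLpNorm_lim_le_liminf_eLpNorm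
        (fun k => hg.aestronglyMeasurable.mul (Lp.aestronglyMeasurable _)) _
        (by filter_upwards [hae] with x hx using hx.const_mul (g x))
    _ ≤ atTop.liminf fun k => K * ‖(z (ns k)).2‖ₑ := liminf_le_liminf (Eventually.of_forall h3)
    _ = K * ‖u.1.2‖ₑ := h2.liminf_eq
    _ = _ := by rw [Lp.enorm_def]; rfl

end Density

/-! ### Norms as integrals -/

section Norms

variable {X F : Type*} [MeasurableSpace X] {μ : Measure X} [NormedAddCommGroup F]

theorem toReal_eLpNorm_rpow {f : X → F} {r : ℝ} (hr : 0 < r) (hf : MemLp f (ENNReal.ofReal r) μ) :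
    (eLpNorm f (ENNReal.ofReal r) μ).toReal ^ r = ∫ x, ‖f x‖ ^ r ∂μ := by
  have h0 : 0 ≤ ∫ x, ‖f x‖ ^ r ∂μ := integral_nonneg fun x => Real.rpow_nonneg (norm_nonneg _) _
  rw [hf.eLpNorm_eq_integral_rpow_norm (by simpa using hr) ENNReal.ofReal_ne_top,
    ENNReal.toReal_ofReal hr.le, ENNReal.toReal_ofReal (Real.rpow_nonneg h0 _),
    Real.rpow_inv_rpow h0 hr.ne']

theorem toReal_eLpNorm_eq {f : X → F} {r : ℝ} (hr : 0 < r) (hf : MemLp f (ENNReal.ofReal r) μ) :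
    (eLpNorm f (ENNReal.ofReal r) μ).toReal = (∫ x, ‖f x‖ ^ r ∂μ) ^ r⁻¹ := by
  rw [← toReal_eLpNorm_rpow hr hf, Real.rpow_rpow_inv ENNReal.toReal_nonneg hr.ne']

/-- Interpolation between Lebesgue spaces, in terms of integrals. -/
theorem integrable_and_integral_rpow_le {f : X → ℝ} {P Q a b : ℝ} (hP : 0 < P) (hQ : 0 < Q)
    (ha : 0 ≤ a) (hb : 0 ≤ b) (hab : a + b = 1) (hfP : MemLp f (ENNReal.ofReal P) μ)
    (hfQ : MemLp f (ENNReal.ofReal Q) μ) :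
    Integrable (fun x => |f x| ^ (P * a + Q * b)) μ ∧
      ∫ x, |f x| ^ (P * a + Q * b) ∂μ ≤ (∫ x, |f x| ^ P ∂μ) ^ a * (∫ x, |f x| ^ Q ∂μ) ^ b := by
  have key : ∀ R : ℝ, 0 < R → MemLp f (ENNReal.ofReal R) μ →
      ∫⁻ x, ENNReal.ofReal (|f x| ^ R) ∂μ = ENNReal.ofReal (∫ x, |f x| ^ R ∂μ) := by
    intro R hR hf
    have hi := hf.integrable_norm_rpow (by simpa using hR) ENNReal.ofReal_ne_top
    rw [ENNReal.toReal_ofReal hR.le] at hi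
    exact (ofReal_integral_eq_lintegral_ofReal hi
      (Eventually.of_forall fun x => Real.rpow_nonneg (abs_nonneg _) _)).symm
  have hm : AEMeasurable (fun x => |f x|) μ := hfP.1.aemeasurable.abs
  have hle : ∫⁻ x, ENNReal.ofReal (|f x| ^ (P * a + Q * b)) ∂μ ≤
      ENNReal.ofReal ((∫ x, |f x| ^ P ∂μ) ^ a * (∫ x, |f x| ^ Q ∂μ) ^ b) := by
    have := ENNReal.lintegral_mul_norm_pow_le (μ := μ)
      (f := fun x => ENNReal.ofReal (|f x| ^ P)) (g := fun x => ENNReal.ofReal (|f x| ^ Q))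
      (hm.pow_const _).ennreal_ofReal (hm.pow_const _).ennreal_ofReal ha hb hab
    rw [key P hP hfP, key Q hQ hfQ] at this
    have hI : ∀ R : ℝ, 0 ≤ ∫ x, |f x| ^ R ∂μ := fun R =>
      integral_nonneg fun x => Real.rpow_nonneg (abs_nonneg _) _
    rw [ENNReal.ofReal_mul (Real.rpow_nonneg (hI P) a), ← ENNReal.ofReal_rpow_of_nonneg (hI P) ha,
      ← ENNReal.ofReal_rpow_of_nonneg (hI Q) hb]
    refine le_trans (le_of_eq (lintegral_congr fun x => ?_)) this
    have hx := abs_nonneg (f x)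
    rw [ENNReal.ofReal_rpow_of_nonneg (Real.rpow_nonneg hx P) ha,
      ENNReal.ofReal_rpow_of_nonneg (Real.rpow_nonneg hx Q) hb,
      ← ENNReal.ofReal_mul (by positivity), ← Real.rpow_mul hx, ← Real.rpow_mul hx,
      ← Real.rpow_add_of_nonneg hx (by positivity) (by positivity)]
  have hi : Integrable (fun x => |f x| ^ (P * a + Q * b)) μ :=
    (lintegral_ofReal_ne_top_iff_integrable (hm.pow_const _).aestronglyMeasurable
      (Eventually.of_forall fun x => Real.rpow_nonneg (abs_nonneg _) _)).1
      (hle.trans_lt ENNReal.ofReal_lt_top).ne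
  refine ⟨hi, ?_⟩
  rw [← ofReal_integral_eq_lintegral_ofReal hi
    (Eventually.of_forall fun x => Real.rpow_nonneg (abs_nonneg _) _)] at hle
  refine (ENNReal.ofReal_le_ofReal_iff ?_).1 hle
  exact mul_nonneg (Real.rpow_nonneg (integral_nonneg fun x => Real.rpow_nonneg (abs_nonneg _) _) _)
    (Real.rpow_nonneg (integral_nonneg fun x => Real.rpow_nonneg (abs_nonneg _) _) _)

end Norms

/-! ### The Sobolev constant -/

section Sobolev

variable {N : ℕ} {Ω : Set (Eu N)} {p : ℝ} [hp : Fact (2 ≤ p)]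

theorem memLp_wval (u : W0 N Ω p) : MemLp (wval u) (ENNReal.ofReal p) (volume.restrict Ω) :=
  Lp.memLp _

theorem memLp_wgrad (u : W0 N Ω p) : MemLp (wgrad u) (ENNReal.ofReal p) (volume.restrict Ω) :=
  Lp.memLp _

variable (N Ω p) in
theorem exists_sobolev_bound (hpN : p < N) : ∃ K : ℝ, 0 ≤ K ∧ ∀ u : W0 N Ω p,
    eLpNorm (wval u) (ENNReal.ofReal (N * p / (N - p))) (volume.restrict Ω) ≤
      ENNReal.ofReal K * eLpNorm (wgrad u) (ENNReal.ofReal p) (volume.restrict Ω) := by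
  have hp2 : 2 ≤ p := hp.out
  have hN : (0 : ℝ) < N := by linarith
  have hNp : (0 : ℝ) < N - p := by linarith
  let K := eLpNormLESNormFDerivOfEqInnerConst (volume : Measure (Eu N)) p.toNNReal
  refine ⟨K, K.2, fun u => ?_⟩
  have h := eLpNorm_mul_wval_le (Ω := Ω) (p := p) (g := fun _ => (1 : ℝ)) measurable_const
    (r := ENNReal.ofReal (N * p / (N - p))) (K := ENNReal.ofReal K) ENNReal.ofReal_ne_top ?_ u
  · simpa using h
  intro φ hφ
  simp only [one_mul]
  rw [hφ.eLpNorm_gradient_restrict, ENNReal.ofReal_coe_nnreal]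
  refine (eLpNorm_mono_measure φ Measure.restrict_le_self).trans ?_
  have := eLpNorm_le_eLpNorm_fderiv_of_eq_inner (volume : Measure (Eu N)) (u := φ)
    (hφ.1.of_le (by simp)) hφ.2.1 (p := p.toNNReal) (p' := (N * p / (N - p)).toNNReal)
    (by rw [← NNReal.coe_le_coe, Real.coe_toNNReal _ (by linarith)]; simpa using by linarith)
    (by simpa using by exact_mod_cast hN) (by
      rw [Real.coe_toNNReal _ (by positivity), NNReal.coe_inv, Real.coe_toNNReal _ (by linarith)]
      simp only [finrank_euclideanSpace, Fintype.card_fin]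
      field_simp)
  refine this.trans (le_of_eq ?_)
  congr 1
  exact eLpNorm_congr_norm_ae (Eventually.of_forall fun x => (norm_gradient_eq_norm_fderiv x).symm)

theorem sobolevConst_nonneg : 0 ≤ sobolevConst N Ω p := Real.sInf_nonneg fun _ h => h.1

theorem eLpNorm_wgrad_ne_top (u : W0 N Ω p) :
    eLpNorm (wgrad u) (ENNReal.ofReal p) (volume.restrict Ω) ≠ ⊤ := (memLp_wgrad u).2.ne

/-- The Sobolev inequality holds with its optimal constant. -/
theorem eLpNorm_wval_le_sobolevConst (hpN : p < N) (u : W0 N Ω p) :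
    eLpNorm (wval u) (ENNReal.ofReal (N * p / (N - p))) (volume.restrict Ω) ≤
      ENNReal.ofReal (sobolevConst N Ω p) *
        eLpNorm (wgrad u) (ENNReal.ofReal p) (volume.restrict Ω) := by
  have hne : Set.Nonempty {C : ℝ | 0 ≤ C ∧ ∀ u : W0 N Ω p,
    eLpNorm (wval u) (ENNReal.ofReal (N * p / (N - p))) (volume.restrict Ω) ≤
      ENNReal.ofReal C * eLpNorm (wgrad u) (ENNReal.ofReal p) (volume.restrict Ω)} :=
    exists_sobolev_bound N Ω p hpN
  obtain ⟨c, -, hc, hmem⟩ := exists_seq_tendsto_sInf hne ⟨0, fun _ h => h.1⟩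
  exact ge_of_tendsto' (ENNReal.Tendsto.mul_const (ENNReal.tendsto_ofReal hc)
    (Or.inr (eLpNorm_wgrad_ne_top u))) fun n => (hmem n).2 u

theorem sobolevConst_pos (hpN : p < N) (u : W0 N Ω p)
    (hu : ¬ wval u =ᵐ[volume.restrict Ω] 0) : 0 < sobolevConst N Ω p := by
  refine lt_of_le_of_ne sobolevConst_nonneg fun h0 => hu ?_
  have h := eLpNorm_wval_le_sobolevConst hpN u
  rw [← h0, ENNReal.ofReal_zero, zero_mul] at h
  have hp2 : 2 ≤ p := hp.out
  have hNp : (0 : ℝ) < N - p := by linarith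
  have hN : (0 : ℝ) < N := by linarith
  refine (eLpNorm_eq_zero_iff (memLp_wval u).1 ?_).1 (le_antisymm h zero_le)
  simpa using by positivity

theorem memLp_wval_sobolev (hpN : p < N) (u : W0 N Ω p) :
    MemLp (wval u) (ENNReal.ofReal (N * p / (N - p))) (volume.restrict Ω) :=
  ⟨(memLp_wval u).1, (eLpNorm_wval_le_sobolevConst hpN u).trans_lt
    (ENNReal.mul_lt_top ENNReal.ofReal_lt_top (memLp_wgrad u).2)⟩

theorem integral_wval_sobolev_le (hpN : p < N) (u : W0 N Ω p) :
    (∫ x in Ω, |wval u x| ^ (N * p / (N - p))) ^ (N * p / (N - p))⁻¹ ≤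
      sobolevConst N Ω p * (∫ x in Ω, ‖wgrad u x‖ ^ p) ^ p⁻¹ := by
  have hp2 : 2 ≤ p := hp.out
  have hNp : (0 : ℝ) < N - p := by linarith
  have hN : (0 : ℝ) < N := by linarith
  have h := ENNReal.toReal_mono (ENNReal.mul_ne_top ENNReal.ofReal_ne_top
    (eLpNorm_wgrad_ne_top u)) (eLpNorm_wval_le_sobolevConst hpN u)
  rwa [ENNReal.toReal_mul, ENNReal.toReal_ofReal sobolevConst_nonneg,
    toReal_eLpNorm_eq (by positivity) (memLp_wval_sobolev hpN u),
    toReal_eLpNorm_eq (by positivity) (memLp_wgrad u)] at h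

end Sobolev

/-! ### The Hardy-Sobolev inequality -/

section Hardy

variable {N : ℕ} {s : ℝ}

theorem locallyIntegrable_norm_rpow_neg (hN : 0 < N) (hs : s < N) :
    LocallyIntegrable (fun x : Eu N => ‖x‖ ^ (-s)) := by
  have : Nontrivial (Eu N) := Module.nontrivial_of_finrank_pos (R := ℝ) (by simpa using hN)
  rw [locallyIntegrable_iff]
  intro k hk
  obtain ⟨R, hR⟩ := hk.isBounded.subset_ball 0
  refine IntegrableOn.mono_set ?_ hR
  rw [integrableOn_fun_norm_addHaar (volume : Measure (Eu N)) (f := fun y => y ^ (-s))]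
  have h : IntegrableOn (fun y : ℝ => y ^ ((N : ℝ) - 1 - s)) (Ioo 0 R) := by
    rcases le_total R 0 with h0 | h0
    · simp [Ioo_eq_empty (not_lt.2 h0)]
    · exact (intervalIntegrable_iff_integrableOn_Ioo_of_le h0).1
        (intervalIntegral.intervalIntegrable_rpow' (by linarith))
  refine h.congr_fun (fun y hy => ?_) measurableSet_Ioo
  simp only [finrank_euclideanSpace, Fintype.card_fin, smul_eq_mul]
  rw [← Real.rpow_natCast, ← Real.rpow_add hy.1, Nat.cast_sub hN, Nat.cast_one]
  rfl

theorem rpow_neg_half_mul_sq (x : Eu N) (y : ℝ) :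
    (‖x‖ ^ (-(s / 2)) * y) ^ 2 = ‖x‖ ^ (-s) * y ^ 2 := by
  rw [mul_pow, ← Real.rpow_mul_natCast (norm_nonneg x)]
  congr 2
  push_cast
  ring

theorem hardySobolevConst_nonneg : 0 ≤ hardySobolevConst N s := Real.sInf_nonneg fun _ h => h.1

/-- The two cases in the definition of `C̃` agree: the exponent of `|Ω|` vanishes in the first. -/
theorem tildeC_eq (Ω : Set (Eu N)) {p : ℝ} (hN : 0 < N) (hs : s < N + 2) :
    tildeC N Ω p s = hardySobolevConst N s * volume.real Ω ^ ((N + 2 - s) / N - 2 / p) := by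
  have h1 : (0 : ℝ) < N := by exact_mod_cast hN
  have h2 : (0 : ℝ) < N + 2 - s := by linarith
  unfold tildeC
  split_ifs with h
  · rw [← h, show ((N : ℝ) + 2 - s) / N - 2 / (2 * N / (N + 2 - s)) = 0 by field_simp; ring,
      Real.rpow_zero, mul_one]
  · rfl

/-- The Hardy-Sobolev inequality holds with its optimal constant, as soon as that constant is
not `0`: the infimum of an empty set of admissible constants would be `0`. -/
theorem integral_le_hardySobolevConst (hC : hardySobolevConst N s ≠ 0) {φ : Eu N → ℝ}
    (hφ : IsTestFunction univ φ) :
    (∫ x, ‖x‖ ^ (-s) * φ x ^ 2) ≤ hardySobolevConst N s *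
      (∫ x, ‖gradient φ x‖ ^ (2 * N / (N + 2 - s))) ^ ((N + 2 - s) / N) := by
  have hne : Set.Nonempty {C : ℝ | 0 ≤ C ∧ ∀ φ : Eu N → ℝ, IsTestFunction Set.univ φ →
    (∫ x, ‖x‖ ^ (-s) * φ x ^ 2) ≤
      C * (∫ x, ‖gradient φ x‖ ^ (2 * N / (N + 2 - s))) ^ ((N + 2 - s) / N)} := by
    by_contra h
    rw [not_nonempty_iff_eq_empty] at h
    exact hC (by rw [hardySobolevConst, h, Real.sInf_empty])
  obtain ⟨c, -, hc, hmem⟩ := exists_seq_tendsto_sInf hne ⟨0, fun _ h => h.1⟩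
  exact ge_of_tendsto' (hc.mul_const _) fun n => (hmem n).2 φ hφ

variable {Ω : Set (Eu N)} {p : ℝ}

theorem tildeC_nonneg : 0 ≤ tildeC N Ω p s := by
  unfold tildeC
  split_ifs
  · exact hardySobolevConst_nonneg
  · exact mul_nonneg hardySobolevConst_nonneg (by positivity)

theorem hardySobolevConst_ne_zero (h : tildeC N Ω p s ≠ 0) : hardySobolevConst N s ≠ 0 := by
  intro h0
  simp [tildeC, h0] at h

variable [hp : Fact (2 ≤ p)]

/-- The Hardy-Sobolev inequality for test functions in `Ω`, with Hölder's inequality on the right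
to pass from the exponent `2N/(N+2-s)` to `p`. -/
theorem eLpNorm_weight_mul_testFunction_le (hpN : p < N) (hs2 : s ≤ 2)
    (hΩ : Bornology.IsBounded Ω) (hC : hardySobolevConst N s ≠ 0) {φ : Eu N → ℝ}
    (hφ : IsTestFunction Ω φ) :
    eLpNorm (fun x => ‖x‖ ^ (-(s / 2)) * φ x) 2 (volume.restrict Ω) ≤
      ENNReal.ofReal (tildeC N Ω p s ^ (1 / 2 : ℝ)) *
        eLpNorm (gradient φ) (ENNReal.ofReal p) (volume.restrict Ω) := by
  have hp2 : 2 ≤ p := hp.out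
  have hN : (0 : ℝ) < N := by linarith
  have hN' : 0 < N := by exact_mod_cast hN
  have hn : (0 : ℝ) < N + 2 - s := by linarith
  set n : ℝ := 2 * N / (N + 2 - s) with hn_def
  have hn0 : 0 < n := by positivity
  have hnp : n ≤ p := by
    rw [hn_def, div_le_iff₀ hn]
    nlinarith
  have hφ' : IsTestFunction univ φ := ⟨hφ.1, hφ.2.1, subset_univ _⟩
  set C := hardySobolevConst N s
  have hC0 : 0 ≤ C := hardySobolevConst_nonneg
  have hgi : MemLp (gradient φ) (ENNReal.ofReal n) volume :=
    hφ.continuous_gradient.memLp_of_hasCompactSupport hφ.hasCompactSupport_gradient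
  -- The constant is defined through Bochner integrals, so integrability has to be known before the
  -- inequality can be read as one between norms. It holds since `s ≤ 2 ≤ p < N`.
  have hint : Integrable (fun x : Eu N => ‖x‖ ^ (-s) * φ x ^ 2) := by
    have hsN : s < N := by linarith
    exact (locallyIntegrable_norm_rpow_neg hN' hsN).integrable_smul_right_of_hasCompactSupport
      (hφ.1.continuous.pow 2) (hφ.2.1.comp_left (g := fun y : ℝ => y ^ 2) (by norm_num))
  have hmem : MemLp (fun x => ‖x‖ ^ (-(s / 2)) * φ x) (ENNReal.ofReal 2)
      (volume : Measure (Eu N)) := by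
    rw [ENNReal.ofReal_ofNat]
    refine (memLp_two_iff_integrable_sq
      ((measurable_norm.pow_const _).aestronglyMeasurable.mul hφ.1.continuous.aestronglyMeasurable)).2 ?_
    simpa only [Pi.mul_apply, rpow_neg_half_mul_sq] using hint
  have hG : 0 ≤ ∫ x, ‖gradient φ x‖ ^ n := integral_nonneg fun x => by positivity
  have hreal : (eLpNorm (fun x => ‖x‖ ^ (-(s / 2)) * φ x) (ENNReal.ofReal 2)
      (volume : Measure (Eu N))).toReal ≤
      C ^ (1 / 2 : ℝ) * (eLpNorm (gradient φ) (ENNReal.ofReal n) volume).toReal := by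
    rw [toReal_eLpNorm_eq two_pos hmem, toReal_eLpNorm_eq hn0 hgi]
    have h1 := integral_le_hardySobolevConst hC hφ'
    have h2 : ∫ x, ‖‖x‖ ^ (-(s / 2)) * φ x‖ ^ (2 : ℝ) = ∫ x, ‖x‖ ^ (-s) * φ x ^ 2 := by
      refine integral_congr_ae (Eventually.of_forall fun x => ?_)
      simp only [Real.rpow_two, Real.norm_eq_abs, sq_abs]
      exact rpow_neg_half_mul_sq x _
    rw [h2]
    refine (Real.rpow_le_rpow (integral_nonneg fun x => by positivity) h1 (by norm_num)).trans ?_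
    rw [Real.mul_rpow hC0 (by positivity), ← Real.rpow_mul hG, one_div,
      show ((N : ℝ) + 2 - s) / N * 2⁻¹ = n⁻¹ by rw [hn_def]; field_simp]
  have hE : eLpNorm (fun x => ‖x‖ ^ (-(s / 2)) * φ x) 2 (volume : Measure (Eu N)) ≤
      ENNReal.ofReal (C ^ (1 / 2 : ℝ)) * eLpNorm (gradient φ) (ENNReal.ofReal n) volume := by
    rw [ENNReal.ofReal_ofNat] at hreal hmem
    rw [← ENNReal.toReal_le_toReal hmem.2.ne (ENNReal.mul_ne_top ENNReal.ofReal_ne_top hgi.2.ne),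
      ENNReal.toReal_mul, ENNReal.toReal_ofReal (by positivity)]
    exact hreal
  have hV : volume Ω ≠ ⊤ := hΩ.measure_lt_top.ne
  have hexp : 0 ≤ 1 / n - 1 / p := sub_nonneg.2 (one_div_le_one_div_of_le hn0 hnp)
  calc _ ≤ eLpNorm (fun x => ‖x‖ ^ (-(s / 2)) * φ x) 2 (volume : Measure (Eu N)) :=
        eLpNorm_mono_measure _ Measure.restrict_le_self
    _ ≤ _ := hE
    _ = ENNReal.ofReal (C ^ (1 / 2 : ℝ)) *
        eLpNorm (gradient φ) (ENNReal.ofReal n) (volume.restrict Ω) := by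
      rw [hφ.eLpNorm_gradient_restrict]
    _ ≤ ENNReal.ofReal (C ^ (1 / 2 : ℝ)) *
        (eLpNorm (gradient φ) (ENNReal.ofReal p) (volume.restrict Ω) *
          volume Ω ^ (1 / n - 1 / p)) := by
      gcongr
      have := eLpNorm_le_eLpNorm_mul_rpow_measure_univ (μ := volume.restrict Ω)
        (f := gradient φ) (ENNReal.ofReal_le_ofReal hnp)
        hφ.continuous_gradient.aestronglyMeasurable
      rwa [Measure.restrict_apply_univ, ENNReal.toReal_ofReal hn0.le,
        ENNReal.toReal_ofReal (by linarith)] at this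
    _ = _ := by
      rw [mul_comm (eLpNorm _ _ _), ← mul_assoc]
      congr 1
      rw [← ENNReal.ofReal_toReal hV, ENNReal.ofReal_rpow_of_nonneg ENNReal.toReal_nonneg hexp,
        ← ENNReal.ofReal_mul (by positivity), tildeC_eq Ω hN' (by linarith),
        Real.mul_rpow hC0 (by positivity), ← Real.rpow_mul measureReal_nonneg]
      congr 3
      rw [hn_def]
      field_simp

variable (s) in
theorem memLp_weight_mul_wval (hpN : p < N) (hs2 : s ≤ 2)
    (hΩ : Bornology.IsBounded Ω) (hC : tildeC N Ω p s ≠ 0) (u : W0 N Ω p) :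
    MemLp (fun x => ‖x‖ ^ (-(s / 2)) * wval u x) (ENNReal.ofReal 2) (volume.restrict Ω) := by
  refine ⟨(measurable_norm.pow_const _).aestronglyMeasurable.mul (memLp_wval u).1, ?_⟩
  rw [ENNReal.ofReal_ofNat]
  exact (eLpNorm_mul_wval_le (measurable_norm.pow_const _) ENNReal.ofReal_ne_top
    (fun φ hφ => eLpNorm_weight_mul_testFunction_le hpN hs2 hΩ
      (hardySobolevConst_ne_zero hC) hφ) u).trans_lt
    (ENNReal.mul_lt_top ENNReal.ofReal_lt_top (memLp_wgrad u).2)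

theorem integral_norm_weight_mul_rpow_two (u : W0 N Ω p) :
    ∫ x in Ω, ‖‖x‖ ^ (-(s / 2)) * wval u x‖ ^ (2 : ℝ) = weightedNormSq s u := by
  refine integral_congr_ae (Eventually.of_forall fun x => ?_)
  simp only [Real.rpow_two, Real.norm_eq_abs, sq_abs]
  exact rpow_neg_half_mul_sq x _

/-- The Hardy-Sobolev inequality on `W_0^{1,p}(Ω)`. -/
theorem weightedNormSq_le (hpN : p < N) (hs2 : s ≤ 2)
    (hΩ : Bornology.IsBounded Ω) (hC : tildeC N Ω p s ≠ 0) (u : W0 N Ω p) :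
    weightedNormSq s u ≤ tildeC N Ω p s * (∫ x in Ω, ‖wgrad u x‖ ^ p) ^ (2 / p) := by
  have hp2 : 2 ≤ p := hp.out
  have hA : 0 ≤ ∫ x in Ω, ‖wgrad u x‖ ^ p := integral_nonneg fun x => by positivity
  have h := eLpNorm_mul_wval_le (measurable_norm.pow_const _) ENNReal.ofReal_ne_top
    (fun φ hφ => eLpNorm_weight_mul_testFunction_le hpN hs2 hΩ
      (hardySobolevConst_ne_zero hC) hφ) u
  have h' := ENNReal.toReal_mono (ENNReal.mul_ne_top ENNReal.ofReal_ne_top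
    (eLpNorm_wgrad_ne_top u)) h
  rw [← integral_norm_weight_mul_rpow_two,
    ← toReal_eLpNorm_rpow two_pos (memLp_weight_mul_wval s hpN hs2 hΩ hC u),
    ENNReal.ofReal_ofNat]
  refine (Real.rpow_le_rpow ENNReal.toReal_nonneg h' two_pos.le).trans (le_of_eq ?_)
  rw [ENNReal.toReal_mul, ENNReal.toReal_ofReal (Real.rpow_nonneg tildeC_nonneg _),
    toReal_eLpNorm_eq (by positivity) (memLp_wgrad u), Real.mul_rpow
      (Real.rpow_nonneg tildeC_nonneg _) (by positivity), ← Real.rpow_mul tildeC_nonneg,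
    ← Real.rpow_mul hA]
  norm_num
  left
  congr 1
  ring

end Hardy

/-! ### The exponents -/

section Exponents

variable {N : ℕ} {p q α : ℝ}

theorem lt_sobolevExponent (hp2 : 2 ≤ p) (hpN : p < N) (hqα : q + α < p * (1 + 2 / N)) :
    q + α < N * p / (N - p) := by
  have hNp : (0 : ℝ) < N - p := by linarith
  have hN : (0 : ℝ) < N := by linarith
  refine hqα.trans ?_
  rw [lt_div_iff₀ hNp, show p * (1 + 2 / (N : ℝ)) * (N - p) = p * ((N + 2) * (N - p)) / N by
    field_simp, div_lt_iff₀ hN]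
  have : ((N : ℝ) + 2) * (N - p) < N * N := by nlinarith
  nlinarith

theorem thetaExp_mul_eq (hr : q + α ≠ 0) : thetaExp N p q α * (q + α) =
    ((q + α) / 2 - 1) * (1 / 2 - (N - p) / (N * p))⁻¹ := by
  unfold thetaExp
  field_simp

theorem half_sub_pos (hp2 : 2 ≤ p) (hpN : p < N) : (0 : ℝ) < 1 / 2 - (N - p) / (N * p) := by
  have hN : (0 : ℝ) < N := by linarith
  have hp : 0 < p := by linarith
  rw [sub_pos, div_lt_div_iff₀ (by positivity) two_pos]
  nlinarith

theorem thetaExp_pos (hp2 : 2 ≤ p) (hpN : p < N) (hpr : p < q + α) : 0 < thetaExp N p q α := by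
  refine mul_pos (sub_pos.2 ?_) (inv_pos.2 (half_sub_pos hp2 hpN))
  exact one_div_lt_one_div_of_lt two_pos (by linarith)

theorem thetaExp_lt_one (hp2 : 2 ≤ p) (hpN : p < N) (hpr : p < q + α)
    (hqα : q + α < p * (1 + 2 / N)) : thetaExp N p q α < 1 := by
  have h1 := one_div_lt_one_div_of_lt (by linarith) (lt_sobolevExponent hp2 hpN hqα)
  rw [one_div_div] at h1
  rw [thetaExp, ← div_eq_mul_inv, div_lt_one (half_sub_pos hp2 hpN)]
  linarith

/-- The restriction `q + α < p (1 + 2/N)` is what makes the gradient term subcritical. -/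
theorem thetaExp_mul_lt (hp2 : 2 ≤ p) (hpN : p < N) (hpr : p < q + α)
    (hqα : q + α < p * (1 + 2 / N)) : thetaExp N p q α * (q + α) < p := by
  have hN : (0 : ℝ) < N := by linarith
  have hp : 0 < p := by linarith
  rw [thetaExp_mul_eq (by linarith), ← div_eq_mul_inv, div_lt_iff₀ (half_sub_pos hp2 hpN)]
  have : p * (1 / 2 - (N - p) / (N * p)) = p * (1 + 2 / N) / 2 - 1 := by
    field_simp
    ring
  linarith

theorem thetaExp_interpolation (hp2 : 2 ≤ p) (hpN : p < N) (hpr : p < q + α) :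
    (1 - thetaExp N p q α) * (q + α) / 2 + thetaExp N p q α * (q + α) / (N * p / (N - p)) = 1 := by
  have h := half_sub_pos hp2 hpN
  have h2 : thetaExp N p q α * (q + α) * (1 / 2 - (N - p) / (N * p)) = (q + α) / 2 - 1 := by
    rw [thetaExp_mul_eq (by linarith), inv_mul_cancel_right₀ h.ne']
  have h3 : thetaExp N p q α * (q + α) / (N * p / (N - p)) =
      thetaExp N p q α * (q + α) * ((N - p) / (N * p)) := by
    rw [div_div_eq_mul_div, mul_div_assoc]
  rw [h3]
  linarith

theorem one_lt_kappaExp (hp2 : 2 ≤ p) (hpN : p < N) (hpr : p < q + α)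
    (hqα : q + α < p * (1 + 2 / N)) : 1 < kappaExp N p q α := by
  have hp : 0 < p := by linarith
  have hN : (0 : ℝ) < N := by linarith
  have hNp : (0 : ℝ) < N - p := by linarith
  have hm : thetaExp N p q α * (q + α) / p < 1 :=
    (div_lt_one hp).2 (thetaExp_mul_lt hp2 hpN hpr hqα)
  rw [kappaExp, one_lt_div (by linarith)]
  have h1 := thetaExp_interpolation hp2 hpN hpr
  have h2 : thetaExp N p q α * (q + α) / (N * p / (N - p)) <
      thetaExp N p q α * (q + α) / p := by
    refine div_lt_div_of_pos_left (mul_pos (thetaExp_pos hp2 hpN hpr) (by linarith)) hp ?_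
    rw [lt_div_iff₀ hNp]
    nlinarith
  linarith

end Exponents

/-! ### Estimates for the energy -/

section Energy

variable {N : ℕ} {Ω : Set (Eu N)} {p : ℝ} [hp : Fact (2 ≤ p)]

theorem integral_wgrad_nonneg (u : W0 N Ω p) : 0 ≤ ∫ x in Ω, ‖wgrad u x‖ ^ p :=
  integral_nonneg fun x => by positivity

theorem weightedNormSq_nonneg (s : ℝ) (u : W0 N Ω p) : 0 ≤ weightedNormSq s u :=
  integral_nonneg fun x => by positivity

/-- Eliminating the logarithmic term in favour of the energy gives coercivity in the
Hardy-Sobolev norm. -/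
theorem coercivity {q s : ℝ} (hpN : p < N) (hs2 : s ≤ 2) (hpq : p < q)
    (hΩ : Bornology.IsBounded Ω) (hC : tildeC N Ω p s ≠ 0) (u : W0 N Ω p) :
    2 * (q - p) / (p * tildeC N Ω p s) *
      (1 / 2 * weightedNormSq s u - tildeC N Ω p s / 2 -
        p * q / (q - p) * (tildeC N Ω p s / 2) * energyJ q u) ≤
      (∫ x in Ω, |wval u x| ^ q * Real.log |wval u x|) - ∫ x in Ω, ‖wgrad u x‖ ^ p := by
  have hp2 : 2 ≤ p := hp.out
  have hp0 : 0 < p := by linarith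
  have hq0 : 0 < q := by linarith
  have hqp : 0 < q - p := by linarith
  have hC0 : 0 < tildeC N Ω p s := lt_of_le_of_ne tildeC_nonneg hC.symm
  have hW := weightedNormSq_le hpN hs2 hΩ hC u
  have hX := integral_wgrad_nonneg u
  have hU : 0 ≤ ∫ x in Ω, |wval u x| ^ q := integral_nonneg fun x => by positivity
  unfold energyJ
  set X := ∫ x in Ω, ‖wgrad u x‖ ^ p
  set U := ∫ x in Ω, |wval u x| ^ q
  set Y := ∫ x in Ω, |wval u x| ^ q * Real.log |wval u x|
  set W := weightedNormSq s u
  set C := tildeC N Ω p s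
  -- As `2 / p ≤ 1`, replacing `‖∇u‖_p^2` by `‖∇u‖_p^p` costs at most the constant `C₁`.
  have hX1 : X ^ (2 / p) ≤ X + 1 := by
    have h2p : 2 / p ≤ 1 := (div_le_one hp0).2 hp2
    rcases le_total X 1 with h | h
    · linarith [Real.rpow_le_one hX h (by positivity : 0 ≤ 2 / p)]
    · have := Real.rpow_le_rpow_of_exponent_le h h2p
      rw [Real.rpow_one] at this
      linarith
  have hWC : W / C ≤ X + 1 := by
    rw [div_le_iff₀ hC0]
    nlinarith
  have e : 2 * (q - p) / (p * C) * (1 / 2 * W - C / 2 - p * q / (q - p) * (C / 2) *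
      (1 / p * X - 1 / q * Y + 1 / q ^ 2 * U)) =
      (q - p) / p * (W / C - 1 - X) + (Y - X) - U / q := by
    field_simp
    ring
  rw [e]
  have h1 : (q - p) / p * (W / C - 1 - X) ≤ 0 :=
    mul_nonpos_of_nonneg_of_nonpos (by positivity) (by linarith)
  have h2 : 0 ≤ U / q := by positivity
  linarith

theorem memLp_wval_two (hΩ : Bornology.IsBounded Ω) (u : W0 N Ω p) :
    MemLp (wval u) (ENNReal.ofReal 2) (volume.restrict Ω) := by
  have : IsFiniteMeasure (volume.restrict Ω) :=
    ⟨by rw [Measure.restrict_apply_univ]; exact hΩ.measure_lt_top⟩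
  exact (memLp_wval u).mono_exponent (ENNReal.ofReal_le_ofReal hp.out)

/-- The weight is bounded below on `Ω`, which contains the origin: `|x| ≤ diam Ω`. -/
theorem integral_wval_sq_le {s : ℝ} (hpN : p < N) (hs0 : 0 ≤ s) (hs2 : s ≤ 2)
    (hΩm : MeasurableSet Ω) (hΩ : Bornology.IsBounded Ω) (hΩ0 : (0 : Eu N) ∈ Ω)
    (hC : tildeC N Ω p s ≠ 0) (u : W0 N Ω p) :
    ∫ x in Ω, |wval u x| ^ (2 : ℝ) ≤ Metric.diam Ω ^ s * weightedNormSq s u := by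
  have hN : 0 < N := by
    have : (2 : ℝ) ≤ p := hp.out
    have : (0 : ℝ) < N := by linarith
    exact_mod_cast this
  have : Nontrivial (Eu N) := Module.nontrivial_of_finrank_pos (R := ℝ) (by simpa using hN)
  rw [weightedNormSq, ← integral_const_mul]
  refine integral_mono_ae ?_ ?_ ?_
  · simpa using (memLp_wval_two hΩ u).integrable_norm_rpow (by simp) ENNReal.ofReal_ne_top
  · refine Integrable.const_mul ?_ _
    have h := memLp_weight_mul_wval s hpN hs2 hΩ hC u
    rw [ENNReal.ofReal_ofNat] at h
    simpa only [rpow_neg_half_mul_sq] using h.integrable_sq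
  · filter_upwards [ae_restrict_mem hΩm, ae_restrict_of_ae (Measure.ae_ne volume (0 : Eu N))]
      with x hx hx0
    have hx0' : 0 < ‖x‖ := norm_pos_iff.2 hx0
    have hd : ‖x‖ ≤ Metric.diam Ω := by
      simpa using Metric.dist_le_diam_of_mem hΩ hx hΩ0
    have h1 : 1 ≤ Metric.diam Ω ^ s * ‖x‖ ^ (-s) := by
      rw [Real.rpow_neg hx0'.le, ← div_eq_mul_inv, one_le_div (Real.rpow_pos_of_pos hx0' s)]
      exact Real.rpow_le_rpow hx0'.le hd hs0
    simp only [Real.rpow_two, sq_abs]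
    nlinarith [sq_nonneg (wval u x)]

theorem integral_rpow_mul_log_le {X : Type*} [MeasurableSpace X] {μ : Measure X} {f : X → ℝ}
    {q α : ℝ} (hq : 0 ≤ q) (hα : 0 < α) (hf : Integrable (fun x => |f x| ^ (q + α)) μ) :
    ∫ x, |f x| ^ q * Real.log |f x| ∂μ ≤ α⁻¹ * ∫ x, |f x| ^ (q + α) ∂μ := by
  by_cases hi : Integrable (fun x => |f x| ^ q * Real.log |f x|) μ
  · rw [← integral_const_mul]
    refine integral_mono hi (hf.const_mul _) fun x => ?_
    have h0 := abs_nonneg (f x)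
    have h1 := mul_le_mul_of_nonneg_left (Real.log_le_rpow_div h0 hα) (Real.rpow_nonneg h0 q)
    calc _ ≤ |f x| ^ q * (|f x| ^ α / α) := h1
      _ = _ := by rw [Real.rpow_add_of_nonneg h0 hq hα.le]; ring
  · -- A non-integrable left-hand side has integral `0` by convention, and the bound is trivial.
    rw [integral_undef hi]
    exact mul_nonneg (inv_nonneg.2 hα.le) (integral_nonneg fun x => by positivity)

/-- Young's inequality, with the factor `α` distributed so as to absorb `X`. -/
theorem inv_mul_le_add_of_young {α A X Z m : ℝ} (hα : 0 < α) (hA : 0 ≤ A) (hX : 0 ≤ X)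
    (hZ : 0 ≤ Z) (hm0 : 0 ≤ m) (hm1 : m < 1) :
    α⁻¹ * (Z * (A * X ^ m)) ≤
      X + α⁻¹ * (A * α ^ (-m)) ^ (1 - m)⁻¹ * Z ^ (1 - m)⁻¹ := by
  have h1m : 0 < 1 - m := by linarith
  have hB : 0 ≤ A * α ^ (-m) := by positivity
  -- The geometric mean of `α X` and `(A α^{-m} Z)^{1/(1-m)}`, with weights `m`, `1-m`, is `Z A X^m`.
  have h := Real.geom_mean_le_arith_mean2_weighted hm0 h1m.le (mul_nonneg hα.le hX)
    (Real.rpow_nonneg (mul_nonneg hB hZ) (1 - m)⁻¹) (by ring)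
  rw [Real.rpow_inv_rpow (mul_nonneg hB hZ) h1m.ne', Real.mul_rpow hα.le hX,
    Real.mul_rpow hB hZ] at h
  have hαm : α ^ m * α ^ (-m) = 1 := by
    rw [← Real.rpow_add hα, add_neg_cancel, Real.rpow_zero]
  have e : α ^ m * X ^ m * (A * α ^ (-m) * Z) = Z * (A * X ^ m) := by
    linear_combination (Z * A * X ^ m) * hαm
  rw [e] at h
  set P := (A * α ^ (-m)) ^ (1 - m)⁻¹ * Z ^ (1 - m)⁻¹ with hP
  have hP0 : 0 ≤ P := by positivity
  have h2 : Z * (A * X ^ m) ≤ α * X + P := by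
    have : m * (α * X) ≤ α * X := mul_le_of_le_one_left (by positivity) hm1.le
    have : (1 - m) * P ≤ P := mul_le_of_le_one_left hP0 (by linarith)
    linarith
  calc _ ≤ α⁻¹ * (α * X + P) := mul_le_mul_of_nonneg_left h2 (by positivity)
    _ = _ := by rw [hP]; field_simp

/-- The reaction term is dominated by the diffusion term plus a power of the weighted norm. -/
theorem reaction_le {q s α : ℝ} (hpN : p < N) (hs0 : 0 ≤ s) (hs2 : s ≤ 2) (hpq : p < q)
    (hα0 : 0 < α) (hqα : q + α < p * (1 + 2 / N)) (hΩm : MeasurableSet Ω)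
    (hΩ : Bornology.IsBounded Ω) (hΩ0 : (0 : Eu N) ∈ Ω) (hC : tildeC N Ω p s ≠ 0)
    (u : W0 N Ω p) :
    (∫ x in Ω, |wval u x| ^ q * Real.log |wval u x|) - ∫ x in Ω, ‖wgrad u x‖ ^ p ≤
      α⁻¹ * (sobolevConst N Ω p ^ (thetaExp N p q α * (q + α)) *
        α ^ (-(thetaExp N p q α * (q + α) / p)) *
        Metric.diam Ω ^ (s * (1 - thetaExp N p q α) * (q + α) / 2)) ^
          (p / (p - thetaExp N p q α * (q + α))) *
      2 ^ kappaExp N p q α * (1 / 2 * weightedNormSq s u) ^ kappaExp N p q α := by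
  have hp2 : 2 ≤ p := hp.out
  have hp0 : 0 < p := by linarith
  have hpr : p < q + α := by linarith
  have hNp : (0 : ℝ) < N - p := by linarith
  have hN : (0 : ℝ) < N := by linarith
  have hθ0 := thetaExp_pos hp2 hpN hpr
  have hθ1 := thetaExp_lt_one hp2 hpN hpr hqα
  have hθp := thetaExp_mul_lt hp2 hpN hpr hqα
  have hab := thetaExp_interpolation hp2 hpN hpr
  have hκ : kappaExp N p q α = (1 - thetaExp N p q α) * (q + α) / 2 *
    (1 - thetaExp N p q α * (q + α) / p)⁻¹ := by rw [kappaExp, div_eq_mul_inv]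
  rw [hκ]
  set θ := thetaExp N p q α
  set r := q + α with hr
  have hr0 : 0 < r := by linarith
  set P := N * p / (N - p) with hPdef
  have hP0 : 0 < P := by positivity
  set a := (1 - θ) * r / 2 with ha
  have ha0 : 0 ≤ a := div_nonneg (mul_nonneg (by linarith) hr0.le) two_pos.le
  have hsum : 2 * a + P * (θ * r / P) = r := by
    rw [mul_div_cancel₀ _ hP0.ne', ha]
    ring
  obtain ⟨hi, hle⟩ := integrable_and_integral_rpow_le two_pos hP0 ha0 (by positivity) hab
    (memLp_wval_two hΩ u) (memLp_wval_sobolev hpN u)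
  rw [hsum] at hi hle
  have hlog := integral_rpow_mul_log_le (μ := volume.restrict Ω) (by linarith) hα0 hi
  have hX := integral_wgrad_nonneg u
  have hW := weightedNormSq_nonneg s u
  have hSob := integral_wval_sobolev_le hpN u
  have hsq := integral_wval_sq_le hpN hs0 hs2 hΩm hΩ hΩ0 hC u
  rw [← hPdef] at hSob
  set X := ∫ x in Ω, ‖wgrad u x‖ ^ p
  set W := weightedNormSq s u
  set S := sobolevConst N Ω p
  have hS : 0 ≤ S := sobolevConst_nonneg
  set D := Metric.diam Ω
  have hD : 0 ≤ D := Metric.diam_nonneg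
  have hIP : 0 ≤ ∫ x in Ω, |wval u x| ^ P := integral_nonneg fun x => by positivity
  have hI2 : 0 ≤ ∫ x in Ω, |wval u x| ^ (2 : ℝ) := integral_nonneg fun x => by positivity
  have h1 : (∫ x in Ω, |wval u x| ^ P) ^ (θ * r / P) ≤ S ^ (θ * r) * X ^ (θ * r / p) := by
    have := Real.rpow_le_rpow (by positivity) hSob (by positivity : 0 ≤ θ * r)
    rwa [← Real.rpow_mul hIP, Real.mul_rpow hS (by positivity), ← Real.rpow_mul hX,
      inv_mul_eq_div, inv_mul_eq_div] at this
  have h2 : (∫ x in Ω, |wval u x| ^ (2 : ℝ)) ^ a ≤ D ^ (s * (1 - θ) * r / 2) * W ^ a := by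
    refine (Real.rpow_le_rpow hI2 hsq ha0).trans (le_of_eq ?_)
    rw [Real.mul_rpow (by positivity) hW, ← Real.rpow_mul hD]
    congr 2
    rw [ha]
    ring
  have hm1 : θ * r / p < 1 := (div_lt_one hp0).2 hθp
  have h3 : ∫ x in Ω, |wval u x| ^ r ≤
      W ^ a * ((S ^ (θ * r) * D ^ (s * (1 - θ) * r / 2)) * X ^ (θ * r / p)) := by
    refine hle.trans ((mul_le_mul h2 h1 (by positivity) (by positivity)).trans (le_of_eq ?_))
    ring
  have h4 := inv_mul_le_add_of_young hα0
    (by positivity : 0 ≤ S ^ (θ * r) * D ^ (s * (1 - θ) * r / 2)) hX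
    (Real.rpow_nonneg hW a) (by positivity : 0 ≤ θ * r / p) hm1
  have h5 := mul_le_mul_of_nonneg_left h3 (inv_nonneg.2 hα0.le)
  have e1 : (1 - θ * r / p)⁻¹ = p / (p - θ * r) := by
    rw [one_sub_div hp0.ne', inv_div]
  rw [← Real.rpow_mul hW] at h4
  have e2 : 2 ^ (a * (1 - θ * r / p)⁻¹) * (1 / 2 * W) ^ (a * (1 - θ * r / p)⁻¹) =
      W ^ (a * (1 - θ * r / p)⁻¹) := by
    rw [← Real.mul_rpow two_pos.le (by positivity)]
    congr 1
    ring
  rw [mul_assoc, e2, ← e1,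
    mul_right_comm (S ^ (θ * r)) (α ^ (-(θ * r / p))) (D ^ (s * (1 - θ) * r / 2))]
  linarith

end Energy

/-! ### Time evolution of weak solutions -/

section Evolution

variable {N : ℕ} {Ω : Set (Eu N)} {p q s : ℝ} [hp : Fact (2 ≤ p)]

theorem norm_sq_eq_weightedNormSq {w : Lp ℝ 2 (volume.restrict Ω)} {u : W0 N Ω p}
    (hw : (w : Eu N → ℝ) =ᵐ[volume.restrict Ω] fun x => ‖x‖ ^ (-(s / 2)) * wval u x) :
    ‖w‖ ^ 2 = weightedNormSq s u := by
  rw [← real_inner_self_eq_norm_sq, L2.inner_def]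
  refine integral_congr_ae ?_
  filter_upwards [hw] with x hx
  rw [hx, ← rpow_neg_half_mul_sq, real_inner_self_eq_norm_sq, Real.norm_eq_abs, sq_abs]

/-- Testing the equation with the solution itself. -/
theorem inner_eq_reaction_sub {v w : Lp ℝ 2 (volume.restrict Ω)} {u : W0 N Ω p}
    (hpq : p < q)
    (hw : (w : Eu N → ℝ) =ᵐ[volume.restrict Ω] fun x => ‖x‖ ^ (-(s / 2)) * wval u x)
    (h : (∫ x in Ω, ‖x‖ ^ (-(s / 2)) * v x * wval u x)
        + (∫ x in Ω, ‖wgrad u x‖ ^ (p - 2) * inner ℝ (wgrad u x) (wgrad u x))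
        = ∫ x in Ω, |wval u x| ^ (q - 2) * wval u x * Real.log |wval u x| * wval u x) :
    inner ℝ w v = (∫ x in Ω, |wval u x| ^ q * Real.log |wval u x|) -
      ∫ x in Ω, ‖wgrad u x‖ ^ p := by
  have hp2 : 2 ≤ p := hp.out
  have hpow : ∀ y r : ℝ, 0 ≤ y → 2 ≤ r → y ^ (r - 2) * y ^ 2 = y ^ r := fun y r hy hr => by
    rw [← Real.rpow_two, ← Real.rpow_add_of_nonneg hy (by linarith) two_pos.le, sub_add_cancel]
  have e1 : inner ℝ w v = ∫ x in Ω, ‖x‖ ^ (-(s / 2)) * v x * wval u x := by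
    rw [L2.inner_def]
    refine integral_congr_ae ?_
    filter_upwards [hw] with x hx
    rw [hx, real_inner_eq_re_inner ℝ, RCLike.inner_apply]
    simp only [conj_trivial, RCLike.re_to_real]
    ring
  have e2 : ∫ x in Ω, ‖wgrad u x‖ ^ (p - 2) * inner ℝ (wgrad u x) (wgrad u x) =
      ∫ x in Ω, ‖wgrad u x‖ ^ p := by
    refine integral_congr_ae (Eventually.of_forall fun x => ?_)
    simp only [real_inner_self_eq_norm_sq]
    exact hpow _ _ (norm_nonneg _) hp2
  have e3 : ∫ x in Ω, |wval u x| ^ (q - 2) * wval u x * Real.log |wval u x| * wval u x =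
      ∫ x in Ω, |wval u x| ^ q * Real.log |wval u x| := by
    refine integral_congr_ae (Eventually.of_forall fun x => ?_)
    simp only
    rw [← hpow |wval u x| q (abs_nonneg _) (by linarith), sq_abs]
    ring
  rw [e1, ← e3, ← h, e2]
  ring

/-- What a weak solution provides on a compact subinterval `[0, b]` of its interval of existence:
an absolutely continuous representative `L` of half the squared weighted norm, with the
concavity inequalities for `L` and `M = L - C₁ - C₂ J`, and the equation tested with `u`. -/
theorem exists_concavityIneq {u₀ : W0 N Ω p} {T : EReal} {u : ℝ → W0 N Ω p}
    (hpN : p < N) (hs2 : s ≤ 2) (hpq : p < q) (hΩ : Bornology.IsBounded Ω)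
    (hC : tildeC N Ω p s ≠ 0) (hu : IsWeakSolution q s u₀ T u) :
    ∃ L M : ℝ → ℝ, (∀ t : ℝ, 0 ≤ t → (t : EReal) < T → L t = 1 / 2 * weightedNormSq s (u t)) ∧
      M 0 = L 0 - tildeC N Ω p s / 2 -
        p * q / (q - p) * (tildeC N Ω p s / 2) * energyJ q u₀ ∧
      ∀ b : ℝ, 0 ≤ b → (b : EReal) < T →
        ConcavityIneq L M b (2 * (q - p) / (p * tildeC N Ω p s)) q ∧
        ∀ᵐ t : ℝ, t ∈ Ioo 0 b → HasDerivAt L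
          ((∫ x in Ω, |wval (u t) x| ^ q * Real.log |wval (u t) x|) -
            ∫ x in Ω, ‖wgrad (u t) x‖ ^ p) t := by
  have hp2 : 2 ≤ p := hp.out
  have hp0 : 0 < p := by linarith
  have hq0 : 0 < q := by linarith
  have hqp : 0 < q - p := by linarith
  have hC0 : 0 < tildeC N Ω p s := lt_of_le_of_ne tildeC_nonneg hC.symm
  obtain ⟨-, -, v, w, hv, hw, hwv, heq, hen⟩ := hu
  set C := tildeC N Ω p s
  set C₂ := p * q / (q - p) * (C / 2) with hC₂
  have hC₂0 : 0 < C₂ := by positivity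
  set k := 2 * (q - p) / (p * C) with hk
  have hk0 : 0 < k := by positivity
  have hkC : k * C₂ = q := by rw [hk, hC₂]; field_simp
  let L : ℝ → ℝ := fun t => 1 / 2 * ‖w t‖ ^ 2
  let I : ℝ → ℝ := fun t => ∫ τ in (0 : ℝ)..t, ‖v τ‖ ^ 2
  let M : ℝ → ℝ := fun t => L t + C₂ * I t + (-(C / 2) - C₂ * energyJ q u₀)
  have hL : ∀ t : ℝ, 0 ≤ t → (t : EReal) < T → L t = 1 / 2 * weightedNormSq s (u t) :=
    fun t h0 hT => by rw [← norm_sq_eq_weightedNormSq (hw t h0 hT)]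
  refine ⟨L, M, hL, by simp only [M, I, intervalIntegral.integral_same]; ring, fun b hb hbT => ?_⟩
  have hlt : ∀ t ≤ b, (t : EReal) < T := fun t ht => lt_of_le_of_lt (EReal.coe_le_coe_iff.2 ht) hbT
  have hwb : ∀ t ∈ Icc 0 b, w t = w 0 + ∫ τ in (0 : ℝ)..t, v τ := fun t ht =>
    hwv t ht.1 (hlt t ht.2)
  have hvb := hv b hbT
  have hLac : AbsolutelyContinuousOnInterval L 0 b := absolutelyContinuousOnInterval_half_norm_sq
    (absolutelyContinuousOnInterval_of_eq_add_integral hb hvb hwb)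
  have hIi := intervalIntegrable_norm_sq_of_memLp_two hb hvb
  have hIac : AbsolutelyContinuousOnInterval I 0 b :=
    hIi.absolutelyContinuousOnInterval_intervalIntegral left_mem_uIcc
  have hder : ∀ᵐ t : ℝ, t ∈ Ioo 0 b → HasDerivAt L (inner ℝ (w t) (v t)) t ∧
      inner ℝ (w t) (v t) = (∫ x in Ω, |wval (u t) x| ^ q * Real.log |wval (u t) x|) -
        ∫ x in Ω, ‖wgrad (u t) x‖ ^ p := by
    filter_upwards [ae_hasDerivAt_half_norm_sq hb hvb hwb, heq] with t h1 h2 hm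
    have htT := hlt t hm.2.le
    exact ⟨h1 hm, inner_eq_reaction_sub hpq (hw t hm.1.le htT) (h2 hm.1 htT (u t))⟩
  refine ⟨⟨hLac, (hLac.fun_add (hIac.const_mul C₂)).fun_add
    (ContDiffOn.absolutelyContinuousOnInterval contDiffOn_const), ?_⟩, ?_⟩
  · filter_upwards [hder, hIi.ae_hasDerivAt_integral, hen] with t h1 h2 h3 hm
    have htT := hlt t hm.2.le
    obtain ⟨hL', hin⟩ := h1 hm
    have hI' := h2 (by rw [uIcc_of_le hb]; exact Ioo_subset_Icc_self hm) 0 left_mem_uIcc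
    refine ⟨inner ℝ (w t) (v t), inner ℝ (w t) (v t) + C₂ * ‖v t‖ ^ 2, hL',
      (hL'.add (hI'.const_mul C₂)).add_const _, ?_, ?_, ?_⟩
    · have hco := coercivity hpN hs2 hpq hΩ hC (u t)
      rw [← hin, ← hL t hm.1.le htT] at hco
      refine le_trans (le_of_eq ?_) hco
      simp only [M, I, ← h3 hm.1 htT]
      ring
    · exact le_add_of_nonneg_right (by positivity)
    · have hcs : inner ℝ (w t) (v t) ^ 2 ≤ ‖w t‖ ^ 2 * ‖v t‖ ^ 2 := by
        rw [← mul_pow, ← sq_abs]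
        exact pow_le_pow_left₀ (abs_nonneg _) (abs_real_inner_le_norm _ _) 2
      calc q * inner ℝ (w t) (v t) ^ 2 ≤ q * (‖w t‖ ^ 2 * ‖v t‖ ^ 2) :=
            mul_le_mul_of_nonneg_left hcs hq0.le
        _ = 2 * k * L t * (inner ℝ (w t) (v t) + C₂ * ‖v t‖ ^ 2 - inner ℝ (w t) (v t)) := by
          rw [← hkC]
          simp only [L]
          ring
  · filter_upwards [hder] with t ht hm
    rw [← (ht hm).2]
    exact (ht hm).1

end Evolution

theorem diam_pos_of_isOpen {N : ℕ} {Ω : Set (Eu N)} (hN : 0 < N) (hΩo : IsOpen Ω)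
    (hΩb : Bornology.IsBounded Ω) (hΩ0 : (0 : Eu N) ∈ Ω) : 0 < Metric.diam Ω := by
  have : Nontrivial (Eu N) := Module.nontrivial_of_finrank_pos (R := ℝ) (by simpa using hN)
  have : (𝓝[≠] (0 : Eu N)).NeBot := Module.punctured_nhds_neBot ℝ (Eu N) 0
  exact Metric.diam_pos (infinite_of_mem_nhds 0 (hΩo.mem_nhds hΩ0)).nontrivial hΩb

end LogFiltration

open LogFiltration in
theorem mainTheorem5 (N : ℕ) (Ω : Set (LogFiltration.Eu N)) (p q s α : ℝ)
    -- `p ≥ 2`, `N > p`, `0 ≤ s ≤ 2`, `p < q < Np/(N-p)`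
    [hp : Fact (2 ≤ p)] (hpN : p < N) (hs0 : 0 ≤ s) (hs2 : s ≤ 2)
    (hpq : p < q) (hq : q < N * p / (N - p))
    -- `Ω` is a bounded domain with smooth boundary, containing the origin
    (hΩo : IsOpen Ω) (hΩc : IsConnected Ω) (hΩb : Bornology.IsBounded Ω)
    (hΩs : LogFiltration.HasSmoothBoundary Ω) (hΩ0 : (0 : LogFiltration.Eu N) ∈ Ω)
    (hα0 : 0 < α) (hα : α ≤ N * p / (N - p) - q) (hqα : q + α < p * (1 + 2 / N))
    -- `T ∈ (0,∞]` is the maximal existence time of the weak solution `u`: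
    -- either `u` is global or it blows up at `T`
    (u₀ : LogFiltration.W0 N Ω p) (T : EReal) (hT : 0 < T) (u : ℝ → LogFiltration.W0 N Ω p)
    (hu : LogFiltration.IsWeakSolution q s u₀ T u)
    (hmax : T = ⊤ ∨ ∃ T₀ : ℝ, T = (T₀ : EReal) ∧ LogFiltration.BlowsUpAt s u T₀)
    -- `0 < C₂ J(u₀) < L(0) - C₁`, `C₁ = C̃/2`, `C₂ = (pq/(q-p)) (C̃/2)`
    (hJ0 : 0 < p * q / (q - p) * (LogFiltration.tildeC N Ω p s / 2) * LogFiltration.energyJ q u₀)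
    (hJL : p * q / (q - p) * (LogFiltration.tildeC N Ω p s / 2) * LogFiltration.energyJ q u₀ <
      1 / 2 * LogFiltration.weightedNormSq s u₀ - LogFiltration.tildeC N Ω p s / 2) :
    (0 < LogFiltration.thetaExp N p q α ∧ LogFiltration.thetaExp N p q α < 1) ∧
    1 < LogFiltration.kappaExp N p q α ∧
    0 < LogFiltration.sobolevConst N Ω p ∧
    T < ⊤ ∧
    ((LogFiltration.lowerBound N Ω p q s α (1 / 2 * LogFiltration.weightedNormSq s u₀) : ℝ) : EReal)
      ≤ T := by
  have hp2 : 2 ≤ p := hp.out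
  have hp0 : 0 < p := by linarith
  have hpr : p < q + α := by linarith
  have hN : 0 < N := by
    have : (0 : ℝ) < N := by linarith
    exact_mod_cast this
  have hC : tildeC N Ω p s ≠ 0 := by
    intro h
    simp [h] at hJ0
  have hC0 : 0 < tildeC N Ω p s := lt_of_le_of_ne tildeC_nonneg hC.symm
  have hκ := one_lt_kappaExp hp2 hpN hpr hqα
  have hL0 : 0 < 1 / 2 * weightedNormSq s u₀ := by linarith
  have hS : 0 < sobolevConst N Ω p := by
    refine sobolevConst_pos hpN u₀ fun h => hL0.ne' ?_
    have : weightedNormSq s u₀ = 0 := by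
      refine integral_eq_zero_of_ae ?_
      filter_upwards [h] with x hx
      simp [hx]
    rw [this, mul_zero]
  obtain ⟨L, M, hL, hM0, hLM⟩ := exists_concavityIneq hpN hs2 hpq hΩb hC hu
  have hLu : L 0 = 1 / 2 * weightedNormSq s u₀ := by
    rw [hL 0 le_rfl (by exact_mod_cast hT), hu.2.1]
  have hMpos : 0 < M 0 := by
    rw [hM0, hLu]
    linarith
  rw [← hLu] at hL0 ⊢
  have hk : 0 < 2 * (q - p) / (p * tildeC N Ω p s) :=
    div_pos (by linarith) (mul_pos hp0 hC0)
  have hTtop : T < ⊤ := by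
    refine lt_of_le_of_ne le_top fun hTt => ?_
    subst hTt
    set c := (q / 2 - 1) * (2 * (q - p) / (p * tildeC N Ω p s) * (M 0 * L 0 ^ (-(q / 2))))
    have hc : 0 < c := mul_pos (by linarith)
      (mul_pos hk (mul_pos hMpos (Real.rpow_pos_of_pos hL0 _)))
    have hR := Real.rpow_pos_of_pos hL0 (1 - q / 2)
    -- The time at which the linearly decreasing bound on `L ^ (1 - q / 2)` becomes negative.
    have hb : 0 ≤ (L 0 ^ (1 - q / 2) + 1) / c := by positivity
    have := (hLM _ hb (EReal.coe_lt_top _)).1.rpow_le hk (by linarith) hMpos hL0 hb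
    rw [mul_div_cancel₀ _ hc.ne'] at this
    linarith
  refine ⟨⟨thetaExp_pos hp2 hpN hpr, thetaExp_lt_one hp2 hpN hpr hqα⟩, hκ, hS, hTtop, ?_⟩
  obtain ⟨T₀, rfl, hblow⟩ := hmax.resolve_left hTtop.ne
  have hT₀ : 0 < T₀ := by exact_mod_cast hT
  rw [EReal.coe_le_coe_iff]
  have hdiam := diam_pos_of_isOpen hN hΩo hΩb hΩ0
  simp only [lowerBound]
  rw [div_le_iff₀ (mul_pos (by positivity) (sub_pos.2 hκ))]
  have hode : ∀ t ∈ Ioo 0 T₀, L 0 ^ (1 - kappaExp N p q α) - L t ^ (1 - kappaExp N p q α) ≤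
      α⁻¹ * (sobolevConst N Ω p ^ (thetaExp N p q α * (q + α)) *
        α ^ (-(thetaExp N p q α * (q + α) / p)) *
        Metric.diam Ω ^ (s * (1 - thetaExp N p q α) * (q + α) / 2)) ^
          (p / (p - thetaExp N p q α * (q + α))) *
      2 ^ kappaExp N p q α * (kappaExp N p q α - 1) * t := by
    intro t ht
    obtain ⟨hcon, hder⟩ := hLM t ht.1.le (EReal.coe_lt_coe_iff.2 ht.2)
    refine rpow_sub_rpow_le_of_ae_hasDerivAt_le hκ ht.1.le hcon.1
      (fun x hx => hL0.trans_le (hcon.le hk.le hMpos hx)) ?_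
    filter_upwards [hder] with x hx hm
    refine ⟨_, hx hm, ?_⟩
    rw [hL x hm.1.le (EReal.coe_lt_coe_iff.2 (hm.2.trans ht.2))]
    exact reaction_le hpN hs0 hs2 hpq hα0 hqα hΩo.measurableSet hΩb hΩ0 hC (u x)
  have hev : ∀ᶠ t in 𝓝[<] T₀, t ∈ Ioo 0 T₀ := Ioo_mem_nhdsLT hT₀
  have hLlim : Tendsto L (𝓝[<] T₀) atTop := by
    refine (hblow.const_mul_atTop (by norm_num : (0 : ℝ) < 1 / 2)).congr' ?_
    filter_upwards [hev] with t ht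
    exact (hL t ht.1.le (EReal.coe_lt_coe_iff.2 ht.2)).symm
  have hzero : Tendsto (fun t => L t ^ (1 - kappaExp N p q α)) (𝓝[<] T₀) (𝓝 0) := by
    have := tendsto_rpow_neg_atTop (sub_pos.2 hκ)
    rw [neg_sub] at this
    exact this.comp hLlim
  have hlim := (tendsto_const_nhds (x := L 0 ^ (1 - kappaExp N p q α))).sub hzero
  rw [sub_zero] at hlim
  refine (le_of_tendsto_of_tendsto hlim
    (((continuous_const_mul _).tendsto T₀).mono_left nhdsWithin_le_nhds)
    (hev.mono hode)).trans (le_of_eq (mul_comm _ _))
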